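/- \textbf{Theorem (Differential zeta connection).} Let $p\in\{0,1,2,\dots\}\cup\{\infty\}$ and let $\eta:\mathbb{R}\to\mathbb{R}$ be a compactly supported even function of class $C^p$ with $\eta(0)=1$. (i) Let $z\in\mathbb{C}\setminus\{1\}$ with $|\operatorname{Re} z-1|<p$ (if $p=\infty$, i.e. if $\eta$ is smooth, this is every complex $z\neq 1$). Then $$\lim_{h\to0^+}\left(\sum_{n=1}^\infty -n^{-z}\log n\;\eta(nh)\;-\;\int_0^\infty -x^{-z}\log x\;\eta(xh)\,dx\right)=\zeta'(z).$$ For $\operatorname{Re} z<1$ the integral converges absolutely. For $\operatorname{Re} z\ge 1$ it is understood as a Hadamard finite part, which exists for every $h>0$. Here the finite part of $\int_0^\infty f(x)\,dx$ is the number $L$ such that $\int_\varepsilon^\infty f(x)\,dx-\sum_{i} c_i\,\varepsilon^{\alpha_i}(\log\varepsilon)^{m_i}\to L$ as $\varepsilon\to0^+$ for some finite sum with $c_i,\alpha_i\in\mathbb{C}$, $m_i\in\{0,1,2,\dots\}$, $\operatorname{Re}\alpha_i\le 0$ and $(\alpha_i,m_i)\ne(0,0)$; it is unique, and equals the ordinary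 integral if that converges absolutely. (ii) Let $K\ge0$ be an integer with $p>2K+1$. With the convention $0^0=1$, consider for $h>0$ the linear system for real weights $w_0^h,\dots,w_K^h$ $$\sum_{j=0}^K w_j^h\,j^{2k}\,\eta(jh)=\int_0^\infty -x^{2k}\log x\;\eta(xh)\,dx-\sum_{n=1}^\infty -n^{2k}\log n\;\eta(nh),\qquad k=0,\dots,K.$$ For all sufficiently small $h>0$ it has exactly one solution, the limits $w_j=\lim_{h\to0^+}w_j^h$ $(j=0,\dots,K)$ exist, and $(w_0,\dots,w_K)$ is the unique real solution of the Vandermonde system $$\sum_{j=0}^K w_j\,j^{2k}=-\zeta'(-2k),\qquad k=0,1,\dots,K.$$ -/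

import Mathlib

open Filter Topology MeasureTheory Set

theorem trigSum_coeff_eq_zero (T : Finset ℝ) : ∀ (c : ℝ → ℂ),
    Tendsto (fun t : ℝ => ∑ σ ∈ T, c σ * Complex.exp ((σ * t : ℝ) * Complex.I)) atTop (𝓝 0) →
    ∀ σ ∈ T, c σ = 0 := by
  classical
  induction T using Finset.induction_on with
  | empty => simp
  | insert a T ha ih =>
    intro c hc
    have key : ∀ σ ∈ T, c σ = 0 := by
      intro σ hσ
      have hne : σ - a ≠ 0 := sub_ne_zero.mpr (fun h => ha (h ▸ hσ))
      set s : ℝ := Real.pi / (σ - a) with hs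
      have h1 := hc.comp (tendsto_atTop_add_const_right atTop s tendsto_id)
      have h2 := h1.sub (hc.const_mul (Complex.exp ((a * s : ℝ) * Complex.I)))
      have h3 := ih (fun x => c x * (Complex.exp ((x * s : ℝ) * Complex.I)
        - Complex.exp ((a * s : ℝ) * Complex.I))) (by
          have h4 : (0 : ℂ) - Complex.exp ((a * s : ℝ) * Complex.I) * 0 = 0 := by simp
          rw [h4] at h2
          refine h2.congr (fun t => ?_)
          simp only [Function.comp, id, Finset.sum_insert ha, mul_add, Finset.mul_sum]
          have e : ∀ x : ℝ, Complex.exp ((x * (t + s) : ℝ) * Complex.I)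
              = Complex.exp ((x * s : ℝ) * Complex.I) * Complex.exp ((x * t : ℝ) * Complex.I) := by
            intro x
            rw [← Complex.exp_add]; congr 1; push_cast; ring
          simp only [← mul_add, e]
          rw [add_sub_add_comm, ← Finset.sum_sub_distrib]
          rw [show ∀ u v w : ℂ, u * (v * w) - v * (u * w) = 0 by intros; ring, zero_add]
          exact Finset.sum_congr rfl (fun x _ => by ring)) σ hσ
      refine (mul_eq_zero.mp h3).resolve_right (fun h5 => ?_)
      have h6 : Complex.exp ((σ * s : ℝ) * Complex.I)
          = -Complex.exp ((a * s : ℝ) * Complex.I) := by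
        have : ((σ * s : ℝ) : ℂ) * Complex.I = (a * s : ℝ) * Complex.I + Real.pi * Complex.I := by
          have : σ * s = a * s + Real.pi := by rw [hs]; field_simp; ring
          rw [this]; push_cast; ring
        rw [this, Complex.exp_add, Complex.exp_pi_mul_I]; ring
      rw [h6] at h5
      exact Complex.exp_ne_zero ((a * s : ℝ) * Complex.I) (by linear_combination (-1 / 2) * h5)
    intro σ hσ
    rcases Finset.mem_insert.mp hσ with rfl | h
    · have h1 : Tendsto (fun t : ℝ => c σ * Complex.exp ((σ * t : ℝ) * Complex.I)) atTop (𝓝 0) := by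
        refine hc.congr (fun t => ?_)
        rw [Finset.sum_insert ha, Finset.sum_eq_zero (fun x hx => by rw [key x hx, zero_mul]),
          add_zero]
      have h2 := h1.norm
      simp only [norm_mul, Complex.norm_exp_ofReal_mul_I, mul_one, norm_zero] at h2
      exact norm_eq_zero.mp (tendsto_nhds_unique tendsto_const_nhds h2)
    · exact key σ h

theorem expPoly_coeff_eq_zero (S : Finset (ℂ × ℕ)) (c : ℂ × ℕ → ℂ)
    (hre : ∀ q ∈ S, 0 ≤ q.1.re)
    (hc : Tendsto (fun t : ℝ => ∑ q ∈ S, c q * (Complex.exp (q.1 * t) * (t : ℂ) ^ q.2))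
      atTop (𝓝 0)) :
    ∀ q ∈ S, c q = 0 := by
  classical
  by_contra! hcon
  set S' := S.filter (fun q => c q ≠ 0) with hS'
  have hne : S'.Nonempty := by
    obtain ⟨q, hq, hq'⟩ := hcon
    exact ⟨q, by simp [hS', hq, hq']⟩
  obtain ⟨⟨b, M⟩, hbM, hmax⟩ := Finset.exists_max_image S' (fun q => toLex (q.1.re, q.2)) hne
  have hc' : Tendsto (fun t : ℝ => ∑ q ∈ S', c q * (Complex.exp (q.1 * t) * (t : ℂ) ^ q.2))
      atTop (𝓝 0) := by
    refine hc.congr (fun t => ?_)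
    rw [hS', Finset.sum_filter]
    exact Finset.sum_congr rfl (fun q _ => by by_cases h : c q = 0 <;> simp [h])
  have hb0 : 0 ≤ b.re := hre _ (Finset.mem_of_mem_filter _ hbM)
  let g : ℝ → ℂ := fun t => Complex.exp (-(b.re * t : ℝ)) * ((t : ℂ) ^ M)⁻¹
  have hg : ∀ᶠ t in atTop, ‖g t‖ ≤ 1 := by
    filter_upwards [eventually_ge_atTop 1] with t ht
    have h1 : ‖Complex.exp (-((b.re * t : ℝ) : ℂ))‖ ≤ 1 := by
      rw [Complex.norm_exp]
      simp only [Complex.neg_re, Complex.ofReal_re]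
      exact Real.exp_le_one_iff.mpr (by nlinarith)
    have h2 : ‖((t : ℂ) ^ M)⁻¹‖ ≤ 1 := by
      rw [norm_inv, norm_pow, Complex.norm_real, Real.norm_of_nonneg (by linarith)]
      exact inv_le_one_of_one_le₀ (one_le_pow₀ ht)
    simp only [g, norm_mul]
    exact mul_le_one₀ h1 (norm_nonneg _) h2
  have hprod : Tendsto (fun t : ℝ => (∑ q ∈ S', c q * (Complex.exp (q.1 * t) * (t : ℂ) ^ q.2)) * g t)
      atTop (𝓝 0) := by
    refine squeeze_zero_norm' ?_ (by simpa using hc'.norm)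
    filter_upwards [hg] with t ht
    rw [norm_mul]
    exact mul_le_of_le_one_right (norm_nonneg _) ht
  let top : ℂ × ℕ → Prop := fun q => q.1.re = b.re ∧ q.2 = M
  have hlow : Tendsto (fun t : ℝ => ∑ q ∈ S'.filter (fun q => ¬ top q),
      c q * (Complex.exp (q.1 * t) * (t : ℂ) ^ q.2) * g t) atTop (𝓝 0) := by
    rw [show (0 : ℂ) = ∑ q ∈ S'.filter (fun q => ¬ top q), (0 : ℂ) by simp]
    refine tendsto_finsetSum _ (fun q hq => ?_)
    obtain ⟨hq1, hq2⟩ := Finset.mem_filter.mp hq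
    have hle := hmax q hq1
    rw [Prod.Lex.toLex_le_toLex] at hle
    rw [show (0 : ℂ) = c q * 0 by simp]
    simp only [mul_assoc]
    refine Tendsto.const_mul _ ?_
    have hnorm : ∀ t : ℝ, 1 ≤ t → ‖Complex.exp (q.1 * t) * ((t : ℂ) ^ q.2 * g t)‖
        = t ^ q.2 * Real.exp (-(b.re - q.1.re) * t) * (t ^ M)⁻¹ := by
      intro t ht
      have ht0 : ‖(t : ℂ)‖ = t := by rw [Complex.norm_real, Real.norm_of_nonneg (by linarith)]
      simp only [g, norm_mul, norm_inv, norm_pow, ht0, Complex.norm_exp]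
      have : Real.exp (-(b.re - q.1.re) * t) = Real.exp (q.1.re * t) * Real.exp (-(b.re * t)) := by
        rw [← Real.exp_add]; congr 1; ring
      rw [this]
      simp only [Complex.neg_re, Complex.ofReal_re, Complex.mul_re, Complex.ofReal_im, mul_zero,
        sub_zero]
      ring
    rw [tendsto_zero_iff_norm_tendsto_zero]
    have hev : (fun t : ℝ => t ^ q.2 * Real.exp (-(b.re - q.1.re) * t) * (t ^ M)⁻¹) =ᶠ[atTop]
        fun t : ℝ => ‖Complex.exp (q.1 * t) * ((t : ℂ) ^ q.2 * g t)‖ := by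
      filter_upwards [eventually_ge_atTop 1] with t ht using (hnorm t ht).symm
    refine Tendsto.congr' hev ?_
    rcases hle with hlt | ⟨heq, hle2⟩
    · have h1 : Tendsto (fun t : ℝ => t ^ q.2 * Real.exp (-(b.re - q.1.re) * t)) atTop (𝓝 0) := by
        have := tendsto_rpow_mul_exp_neg_mul_atTop_nhds_zero (q.2 : ℝ) (b.re - q.1.re)
          (sub_pos.mpr hlt)
        simpa only [Real.rpow_natCast] using this
      refine squeeze_zero' ?_ ?_ h1
      · filter_upwards [eventually_ge_atTop 1] with t ht
        have : 0 ≤ t := by linarith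
        positivity
      · filter_upwards [eventually_ge_atTop 1] with t ht
        have : 0 ≤ t := by linarith
        exact mul_le_of_le_one_right (by positivity) (inv_le_one_of_one_le₀ (one_le_pow₀ ht))
    · have hlt2 : q.2 < M := lt_of_le_of_ne hle2 (fun h => hq2 ⟨heq, h⟩)
      have h1 := tendsto_pow_div_pow_atTop_zero (𝕜 := ℝ) hlt2
      refine h1.congr (fun t => ?_)
      have : q.1.re = b.re := heq
      rw [this, sub_self, neg_zero, zero_mul, Real.exp_zero, mul_one, div_eq_mul_inv]
  have htop := hprod.sub hlow
  rw [sub_zero] at htop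
  have htrig : Tendsto (fun t : ℝ => ∑ σ ∈ (S'.filter top).image (fun q => q.1.im),
      c (⟨b.re, σ⟩, M) * Complex.exp ((σ * t : ℝ) * Complex.I)) atTop (𝓝 0) := by
    refine htop.congr' ?_
    filter_upwards [eventually_gt_atTop 0] with t ht
    rw [Finset.sum_mul, ← Finset.sum_filter_add_sum_filter_not S' top, add_sub_cancel_right,
      Finset.sum_image]
    · refine Finset.sum_congr rfl (fun q hq => ?_)
      obtain ⟨-, h1, h2⟩ := Finset.mem_filter.mp hq
      have hq' : ((⟨b.re, q.1.im⟩, M) : ℂ × ℕ) = q := by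
        rw [← h1, ← h2]
      rw [hq', h2]
      have ht' : (t : ℂ) ^ M ≠ 0 := pow_ne_zero _ (by exact_mod_cast ht.ne')
      simp only [g]
      have : Complex.exp ((q.1.im * t : ℝ) * Complex.I)
          = Complex.exp (q.1 * t) * Complex.exp (-(b.re * t : ℝ)) := by
        rw [← Complex.exp_add]
        congr 1
        nth_rewrite 2 [← Complex.re_add_im q.1]
        rw [h1]; push_cast; ring
      rw [this]
      field_simp
    · intro q hq q' hq' h
      obtain ⟨-, h1, h2⟩ := Finset.mem_filter.mp (Finset.mem_coe.mp hq)
      obtain ⟨-, h1', h2'⟩ := Finset.mem_filter.mp (Finset.mem_coe.mp hq')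
      exact Prod.ext (Complex.ext (h1.trans h1'.symm) h) (h2.trans h2'.symm)
  have := trigSum_coeff_eq_zero _ (fun σ => c (⟨b.re, σ⟩, M)) htrig b.im
    (Finset.mem_image.mpr ⟨(b, M), Finset.mem_filter.mpr ⟨hbM, rfl, rfl⟩, rfl⟩)
  exact (Finset.mem_filter.mp hbM).2 this

/-- `L` is the Hadamard finite part at `0` of the integral of `f` over `(0, ∞)`: the integrals over
`(ε, ∞)` converge to `L` as `ε → 0⁺` after subtraction of finitely many terms
`c ε ^ α (log ε) ^ m` with `Re α ≤ 0` and `(α, m) ≠ (0, 0)`. -/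
def HasFinitePart (f : ℝ → ℂ) (L : ℂ) : Prop :=
  (∀ ε : ℝ, 0 < ε → IntegrableOn f (Ioi ε)) ∧
  ∃ (S : Finset (ℂ × ℕ)) (c : ℂ × ℕ → ℂ), (∀ q ∈ S, q.1.re ≤ 0 ∧ q ≠ (0, 0)) ∧
    Tendsto (fun ε : ℝ => (∫ x in Ioi ε, f x)
      - ∑ q ∈ S, c q * ((ε : ℂ) ^ q.1 * (Real.log ε : ℂ) ^ q.2)) (𝓝[>] 0) (𝓝 L)

theorem HasFinitePart.unique {f : ℝ → ℂ} {L L' : ℂ} (h : HasFinitePart f L)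
    (h' : HasFinitePart f L') : L = L' := by
  classical
  obtain ⟨-, S, c, hS, hc⟩ := h
  obtain ⟨-, S', c', hS', hc'⟩ := h'
  have hexp : Tendsto (fun t : ℝ => Real.exp (-t)) atTop (𝓝[>] 0) :=
    tendsto_nhdsWithin_iff.mpr ⟨Real.tendsto_exp_neg_atTop_nhds_zero,
      Eventually.of_forall (fun t => Real.exp_pos _)⟩
  have hd := ((hc'.sub hc).sub_const (L' - L)).comp hexp
  rw [sub_self] at hd
  let d : ℂ × ℕ → ℂ := fun q => (if q ∈ S then c q else 0) - (if q ∈ S' then c' q else 0)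
  let T : Finset (ℂ × ℕ) := S ∪ S'
  have hT0 : ∀ q ∈ T, q.1.re ≤ 0 ∧ q ≠ (0, 0) := by
    intro q hq
    rcases Finset.mem_union.mp hq with h | h
    · exact hS q h
    · exact hS' q h
  have h0T : ((0, 0) : ℂ × ℕ) ∉ T := fun h => (hT0 _ h).2 rfl
  let neg : ℂ × ℕ → ℂ × ℕ := fun q => (-q.1, q.2)
  have hneg : ∀ q, neg (neg q) = q := fun q => by simp [neg]
  have hninj : Function.Injective neg := Function.LeftInverse.injective hneg
  let e : ℂ × ℕ → ℂ := fun q =>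
    if q = (0, 0) then L - L' else d (neg q) * (-1) ^ q.2
  have hmem0 : ((0, 0) : ℂ × ℕ) ∉ T.image neg := by
    intro h
    obtain ⟨q, hq, hq'⟩ := Finset.mem_image.mp h
    apply h0T
    have : q = (0, 0) := by rw [← hneg q, hq']; simp [neg]
    rwa [← this]
  have := expPoly_coeff_eq_zero (insert (0, 0) (T.image neg)) e ?_ ?_ (0, 0)
    (Finset.mem_insert_self _ _)
  · simpa [e, sub_eq_zero] using this
  · intro q hq
    rcases Finset.mem_insert.mp hq with rfl | h
    · simp
    · obtain ⟨r, hr, rfl⟩ := Finset.mem_image.mp h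
      simpa [neg] using (hT0 r hr).1
  · refine hd.congr (fun t => ?_)
    rw [Finset.sum_insert hmem0, Finset.sum_image (fun _ _ _ _ h => hninj h)]
    have hterm : ∀ q : ℂ × ℕ, ((Real.exp (-t) : ℝ) : ℂ) ^ q.1 * (Real.log (Real.exp (-t)) : ℂ) ^ q.2
        = (-1) ^ q.2 * (Complex.exp ((neg q).1 * t) * (t : ℂ) ^ (neg q).2) := by
      intro q
      rw [Real.log_exp, Complex.cpow_def_of_ne_zero (by exact_mod_cast (Real.exp_pos _).ne'),
        ← Complex.ofReal_log (Real.exp_pos _).le, Real.log_exp]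
      simp only [neg]
      rw [Complex.ofReal_neg, neg_pow (t : ℂ),
        show -(t : ℂ) * q.1 = -q.1 * t by ring]
      ring
    have hsumS : ∀ (U : Finset (ℂ × ℕ)) (a F : ℂ × ℕ → ℂ), U ⊆ T →
        ∑ q ∈ U, a q * F q = ∑ q ∈ T, (if q ∈ U then a q else 0) * F q := by
      intro U a F hU
      rw [← Finset.sum_subset hU (f := fun q => (if q ∈ U then a q else 0) * F q)]
      · exact Finset.sum_congr rfl (fun q hq => by simp [hq])
      · intro q _ hq; simp [hq]
    have hE : ∀ q ∈ T, e (neg q) * (Complex.exp ((neg q).1 * t) * (t : ℂ) ^ (neg q).2)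
        = d q * (((Real.exp (-t) : ℝ) : ℂ) ^ q.1 * (Real.log (Real.exp (-t)) : ℂ) ^ q.2) := by
      intro q hq
      have : neg q ≠ (0, 0) := fun h => hmem0 (h ▸ Finset.mem_image_of_mem neg hq)
      rw [hterm]
      simp only [e, if_neg this, hneg]
      simp only [neg]
      ring
    rw [Finset.sum_congr rfl hE]
    simp only [Function.comp]
    rw [hsumS S c _ Finset.subset_union_left, hsumS S' c' _ Finset.subset_union_right]
    simp only [d, sub_mul, Finset.sum_sub_distrib]
    simp [e]
    ring

open Classical in
/-- The Hadamard finite part of the integral of `f` over `(0, ∞)` (by convention `0` if there is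
none). -/
noncomputable def finitePart (f : ℝ → ℂ) : ℂ :=
  if h : ∃ L, HasFinitePart f L then h.choose else 0

theorem HasFinitePart.finitePart_eq {f : ℝ → ℂ} {L : ℂ} (h : HasFinitePart f L) :
    finitePart f = L := by
  have h' : ∃ L, HasFinitePart f L := ⟨L, h⟩
  rw [finitePart, dif_pos h']
  exact h'.choose_spec.unique h

/-- The finite part is the ordinary integral whenever the latter converges absolutely. -/
theorem hasFinitePart_of_integrableOn {f : ℝ → ℂ} (hf : IntegrableOn f (Ioi 0)) :
    HasFinitePart f (∫ x in Ioi 0, f x) := by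
  refine ⟨fun ε hε => hf.mono_set (Ioi_subset_Ioi hε.le), ∅, 0, by simp, ?_⟩
  simp only [Finset.sum_empty, sub_zero]
  have h1 : Tendsto (fun ε : ℝ => ∫ x, (Ioi ε).indicator f x ∂(volume.restrict (Ioi 0)))
      (𝓝[>] 0) (𝓝 (∫ x in Ioi 0, f x)) := by
    refine tendsto_integral_filter_of_dominated_convergence (fun x => ‖f x‖) ?_ ?_ hf.norm ?_
    · exact Eventually.of_forall (fun ε => hf.aestronglyMeasurable.indicator measurableSet_Ioi)
    · exact Eventually.of_forall (fun ε => Eventually.of_forall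
        (fun x => norm_indicator_le_norm_self _ _))
    · filter_upwards [ae_restrict_mem measurableSet_Ioi] with x hx
      refine tendsto_const_nhds.congr' ?_
      filter_upwards [nhdsWithin_le_nhds (Iio_mem_nhds (mem_Ioi.mp hx))] with ε hε
      rw [indicator_of_mem (mem_Ioi.mpr hε)]
  refine h1.congr' ?_
  filter_upwards [self_mem_nhdsWithin] with ε hε
  rw [integral_indicator measurableSet_Ioi, Measure.restrict_restrict measurableSet_Ioi,
    inter_eq_left.mpr (Ioi_subset_Ioi (le_of_lt hε))]

/-- A cutoff function of class `C^p`: `p` times continuously differentiable on the real line,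
compactly supported, even, with value `1` at the origin. -/
structure IsCutoff (p : ℕ∞) (η : ℝ → ℝ) : Prop where
  contDiff : ContDiff ℝ p η
  hasCompactSupport : HasCompactSupport η
  even : ∀ x, η (-x) = η x
  map_zero : η 0 = 1

/-- The function `x ↦ -x ^ (-z) log x · η (x h)`, for `x > 0`. -/
noncomputable def logIntegrand (η : ℝ → ℝ) (z : ℂ) (h x : ℝ) : ℂ :=
  -((x : ℂ) ^ (-z) * (Real.log x : ℂ)) * (η (x * h) : ℂ)

/-- The sum over `n ≥ 1` of `-n ^ (-z) log n · η (n h)`; for compactly supported `η` and `h > 0`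
only finitely many terms are nonzero. -/
noncomputable def logSum (η : ℝ → ℝ) (z : ℂ) (h : ℝ) : ℂ :=
  ∑' n : ℕ, logIntegrand η z h ((n : ℝ) + 1)

/-- The moment-fitting equations with parameter `h` for the logarithmic singularity, with unknown
weights `w 0, …, w K`. -/
def SolvesLogMomentSystem (η : ℝ → ℝ) (K : ℕ) (h : ℝ) (w : Fin (K + 1) → ℝ) : Prop :=
  ∀ k : Fin (K + 1),
    ∑ j : Fin (K + 1), w j * (j : ℝ) ^ (2 * (k : ℕ)) * η ((j : ℝ) * h) =
      (∫ x in Ioi (0 : ℝ), -(x ^ (2 * (k : ℕ)) * Real.log x) * η (x * h)) -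
        ∑' n : ℕ, -(((n : ℝ) + 1) ^ (2 * (k : ℕ)) * Real.log ((n : ℝ) + 1)) * η (((n : ℝ) + 1) * h)

/-- The Vandermonde system `∑ j, w j * j ^ (2 k) = -ζ'(-2 k)`, `k = 0, …, K`. -/
def SolvesZetaPrimeSystem (K : ℕ) (w : Fin (K + 1) → ℝ) : Prop :=
  ∀ k : Fin (K + 1),
    ∑ j : Fin (K + 1), (w j : ℂ) * (j : ℂ) ^ (2 * (k : ℕ)) =
      -deriv riemannZeta (-2 * (k : ℂ))

/-! The integral is split at x = 1, independently of h, and each side is followed as h → 0.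

Away from the origin, the sum minus the integral over (1, ∞) of x^(-z) η(xh), called
`sumSubIntegral`, is an entire function of z for each h > 0. Differentiating x^(-z) φ(xh) in x gives
a combination of x^(-z-1) ψ(xh) with ψ(y) = y φ'(y) and ψ = φ, and no power of h appears. So for η
of class C^(m+1), m + 1 Euler–Maclaurin steps reduce the half-plane Re z > -m to Re z > 1, where
dominated convergence gives a locally uniform limit. The limit is therefore holomorphic on Re z >
-m. For Re z > 1 it is ζ(z) - 1/(z-1), hence also on the rest of the half-plane except at 1. Locally
uniform limits of holomorphic functions commute with d/dz, so the logarithmic sums minus integrals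
over (1, ∞) tend to ζ'(z) + 1/(z-1)^2 (`tendsto_logSum_sub_integral_Ioi_one`).

On (0, 1], Taylor's formula replaces η(xh) by a polynomial in xh. The constant term contributes the
finite part of -x^(-z) log x, which is 1/(z-1)^2. The other terms carry h^j with j ≥ 1, and the
remainder is O(h^(m+1)) with a convergent integral as long as Re z < m + 2
(`exists_hasFinitePart_logIntegrand`). The two copies of 1/(z-1)^2 cancel.

For the weights, (i) at z = -2k gives the limit of the right-hand sides. The matrices depend
continuously on h and become, at h = 0, a transposed Vandermonde matrix with distinct nodes j^2, so
solutions exist, are unique and converge. -/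

/-! ### Euler–Maclaurin summation on [1, ∞) -/

/-- The `1`-periodic extension of the Bernoulli polynomial `B_k` on `[0, 1)`. -/
noncomputable def sawBernoulli (k : ℕ) (x : ℝ) : ℝ := bernoulliFun k (Int.fract x)

theorem measurable_sawBernoulli (k : ℕ) : Measurable (sawBernoulli k) :=
  (continuous_bernoulliFun k).measurable.comp measurable_fract

theorem exists_abs_sawBernoulli_le (k : ℕ) : ∃ C, 0 ≤ C ∧ ∀ x, |sawBernoulli k x| ≤ C := by
  obtain ⟨C, hC⟩ := (isCompact_Icc (a := (0 : ℝ)) (b := 1)).exists_bound_of_continuousOn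
    (continuous_bernoulliFun k).continuousOn
  exact ⟨C, (norm_nonneg _).trans (hC 0 (by simp)),
    fun x => hC _ ⟨Int.fract_nonneg x, (Int.fract_lt_one x).le⟩⟩

theorem integrableOn_Ioi_of_eq_zero_of_le {u : ℝ → ℂ} {a N : ℝ} (hu : ContinuousOn u (Ici a))
    (hN : ∀ x, N ≤ x → u x = 0) : IntegrableOn u (Ioi a) := by
  have h1 : IntegrableOn u (Icc a N) :=
    (hu.mono Icc_subset_Ici_self).integrableOn_compact isCompact_Icc
  have h2 : IntegrableOn u (Ioi N) :=
    integrableOn_zero.congr_fun (fun x hx => (hN x (le_of_lt hx)).symm) measurableSet_Ioi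
  refine (h1.union h2).mono_set (fun x hx => ?_)
  rcases le_or_gt x N with h | h
  · exact Or.inl ⟨le_of_lt hx, h⟩
  · exact Or.inr h

theorem MeasureTheory.IntegrableOn.sawBernoulli_mul {u : ℝ → ℂ} {s : Set ℝ}
    (hu : IntegrableOn u s) (k : ℕ) : IntegrableOn (fun x => (sawBernoulli k x : ℂ) * u x) s := by
  obtain ⟨C, -, hC⟩ := exists_abs_sawBernoulli_le k
  refine Integrable.bdd_mul (c := C) hu ?_ ?_
  · exact (Complex.measurable_ofReal.comp (measurable_sawBernoulli k)).aestronglyMeasurable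
  · exact Eventually.of_forall (fun x => by simpa using hC x)

/-- Integration by parts with the antiderivative B_{k+1}(x - n) / (k + 1) of B_k(x - n). The values
at 0 and 1 are kept apart because they differ for B_1, that is for k = 0. -/
theorem integral_sawBernoulli_mul_unit (k n : ℕ) {u u' : ℝ → ℂ}
    (hu : ∀ x ∈ Icc (n : ℝ) (n + 1), HasDerivAt u (u' x) x)
    (hu' : ContinuousOn u' (Icc (n : ℝ) (n + 1))) :
    ∫ x in (n : ℝ)..(n + 1), (sawBernoulli k x : ℂ) * u x =
      ((bernoulliFun (k + 1) 1 : ℂ) * u (n + 1) - (bernoulliFun (k + 1) 0 : ℂ) * u n) / (k + 1)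
        - 1 / (k + 1) * ∫ x in (n : ℝ)..(n + 1), (sawBernoulli (k + 1) x : ℂ) * u' x := by
  have hle : (n : ℝ) ≤ n + 1 := by linarith
  have hcongr : ∀ (j : ℕ) (v : ℝ → ℂ), ∫ x in (n : ℝ)..(n + 1), (sawBernoulli j x : ℂ) * v x =
      ∫ x in (n : ℝ)..(n + 1), (bernoulliFun j (x - n) : ℂ) * v x := by
    intro j v
    -- The right endpoint is discarded because the fractional part jumps there.
    rw [intervalIntegral.integral_of_le hle, intervalIntegral.integral_of_le hle,
      integral_Ioc_eq_integral_Ioo, integral_Ioc_eq_integral_Ioo]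
    refine setIntegral_congr_fun measurableSet_Ioo (fun x hx => ?_)
    have : Int.fract x = x - n := by
      rw [Int.fract_eq_iff]
      exact ⟨by linarith [hx.1], by linarith [hx.2], n, by simp⟩
    simp only [sawBernoulli, this]
  rw [hcongr, hcongr]
  have hk : (k + 1 : ℂ) ≠ 0 := Nat.cast_add_one_ne_zero k
  have hB : ∀ x ∈ uIcc (n : ℝ) (n + 1), HasDerivAt
      (fun x : ℝ => ((bernoulliFun (k + 1) (x - n) : ℝ) : ℂ) / (k + 1))
      ((bernoulliFun k (x - n) : ℝ) : ℂ) x := by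
    intro x _
    have h := ((antideriv_bernoulliFun k (x - n)).comp x ((hasDerivAt_id x).sub_const (n : ℝ)))
    have := h.ofReal_comp
    simpa [Function.comp_def] using this
  have hint : IntervalIntegrable u' volume (n : ℝ) (n + 1) := by
    apply ContinuousOn.intervalIntegrable
    rwa [uIcc_of_le hle]
  have hcB : Continuous (fun x : ℝ => ((bernoulliFun k (x - n) : ℝ) : ℂ)) := by fun_prop
  have := intervalIntegral.integral_mul_deriv_eq_deriv_mul (u := fun x : ℝ =>
      ((bernoulliFun (k + 1) (x - n) : ℝ) : ℂ) / (k + 1)) (v := u) (v' := u') hB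
    (by rwa [uIcc_of_le hle]) (hcB.intervalIntegrable _ _) hint
  rw [← intervalIntegral.integral_const_mul]
  have h2 : ∀ x, (1 : ℂ) / (k + 1) * ((bernoulliFun (k + 1) (x - n) : ℂ) * u' x)
      = (bernoulliFun (k + 1) (x - n) : ℂ) / (k + 1) * u' x := fun x => by ring
  simp only [h2]
  rw [this]
  simp
  ring

theorem setIntegral_Ioi_one_eq_sum {v : ℝ → ℂ} {N : ℕ} (hN1 : 1 ≤ N) (hv : IntegrableOn v (Ioi 1))
    (hN : ∀ x, (N : ℝ) ≤ x → v x = 0) :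
    ∫ x in Ioi (1 : ℝ), v x = ∑ n ∈ Finset.Ico 1 N, ∫ x in (n : ℝ)..(n + 1), v x := by
  have h1 : ∫ x in Ioi (1 : ℝ), v x = ∫ x in (1 : ℝ)..N, v x := by
    rw [intervalIntegral.integral_of_le (by exact_mod_cast hN1)]
    refine (setIntegral_eq_of_subset_of_forall_sdiff_eq_zero measurableSet_Ioi
      Ioc_subset_Ioi_self (fun x hx => hN x ?_))
    by_contra h
    exact hx.2 ⟨hx.1, (not_le.mp h).le⟩
  rw [h1]
  have := intervalIntegral.sum_integral_adjacent_intervals_Ico (f := v) (μ := volume)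
    (a := fun n : ℕ => (n : ℝ)) hN1 (fun n hn => by
      rw [intervalIntegrable_iff_integrableOn_Ioc_of_le (by simp)]
      refine hv.mono_set (fun x hx => ?_)
      have : (1 : ℝ) ≤ n := by exact_mod_cast hn.1
      exact lt_of_le_of_lt this hx.1)
  push_cast at this
  exact this.symm

/-- One step of Euler–Maclaurin summation on `[1, ∞)` for a function vanishing near infinity. -/
theorem integral_sawBernoulli_mul_Ioi (k : ℕ) {N : ℕ} (hN1 : 1 ≤ N) {u u' : ℝ → ℂ}
    (hu : ∀ x, 1 ≤ x → HasDerivAt u (u' x) x) (hu' : ContinuousOn u' (Ici 1))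
    (hN : ∀ x, (N : ℝ) ≤ x → u x = 0) (hN' : ∀ x, (N : ℝ) ≤ x → u' x = 0) :
    ∫ x in Ioi (1 : ℝ), (sawBernoulli k x : ℂ) * u x =
      (∑ n ∈ Finset.Ico 1 N, ((bernoulliFun (k + 1) 1 : ℂ) * u (n + 1)
        - (bernoulliFun (k + 1) 0 : ℂ) * u n)) / (k + 1)
      - 1 / (k + 1) * ∫ x in Ioi (1 : ℝ), (sawBernoulli (k + 1) x : ℂ) * u' x := by
  have hcu : ContinuousOn u (Ici 1) := fun x hx => (hu x hx).continuousAt.continuousWithinAt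
  rw [setIntegral_Ioi_one_eq_sum hN1
      ((integrableOn_Ioi_of_eq_zero_of_le hcu hN).sawBernoulli_mul k)
      (fun x hx => by rw [hN x hx, mul_zero]),
    setIntegral_Ioi_one_eq_sum hN1
      ((integrableOn_Ioi_of_eq_zero_of_le hu' hN').sawBernoulli_mul (k + 1))
      (fun x hx => by rw [hN' x hx, mul_zero]), Finset.mul_sum, Finset.sum_div,
    ← Finset.sum_sub_distrib]
  refine Finset.sum_congr rfl (fun n hn => ?_)
  have h1 : (1 : ℝ) ≤ n := by exact_mod_cast (Finset.mem_Ico.mp hn).1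
  exact integral_sawBernoulli_mul_unit k n (fun x hx => hu x (h1.trans hx.1))
    (hu'.mono (fun x hx => h1.trans hx.1))

/-- For k ≥ 1 the polynomial B_{k+1} takes equal values at 0 and 1, so the boundary terms telescope
and only the one at x = 1 survives. -/
theorem integral_sawBernoulli_mul_Ioi_of_pos {k : ℕ} (hk : k ≠ 0) {N : ℕ} (hN1 : 1 ≤ N)
    {u u' : ℝ → ℂ} (hu : ∀ x, 1 ≤ x → HasDerivAt u (u' x) x) (hu' : ContinuousOn u' (Ici 1))
    (hN : ∀ x, (N : ℝ) ≤ x → u x = 0) (hN' : ∀ x, (N : ℝ) ≤ x → u' x = 0) :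
    ∫ x in Ioi (1 : ℝ), (sawBernoulli k x : ℂ) * u x =
      -((bernoulliFun (k + 1) 0 : ℂ) / (k + 1)) * u 1
      - 1 / (k + 1) * ∫ x in Ioi (1 : ℝ), (sawBernoulli (k + 1) x : ℂ) * u' x := by
  rw [integral_sawBernoulli_mul_Ioi k hN1 hu hu' hN hN',
    bernoulliFun_endpoints_eq_of_ne_one (by simpa using hk)]
  congr 1
  simp only [← mul_sub]
  rw [← Finset.mul_sum]
  have := Finset.sum_Ico_sub (fun n : ℕ => u n) hN1
  push_cast at this
  rw [this, hN N le_rfl]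
  ring

/-- The case k = 0: B_1 takes the values -1/2 and 1/2 at the endpoints, so the boundary terms form a
trapezoidal sum, which differs from the full sum by half of the first term. -/
theorem sum_sub_integral_Ioi_one {N : ℕ} (hN1 : 1 ≤ N)
    {u u' : ℝ → ℂ} (hu : ∀ x, 1 ≤ x → HasDerivAt u (u' x) x) (hu' : ContinuousOn u' (Ici 1))
    (hN : ∀ x, (N : ℝ) ≤ x → u x = 0) (hN' : ∀ x, (N : ℝ) ≤ x → u' x = 0) :
    ∑' n : ℕ, u ((n : ℝ) + 1) - ∫ x in Ioi (1 : ℝ), u x =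
      u 1 / 2 + ∫ x in Ioi (1 : ℝ), (sawBernoulli 1 x : ℂ) * u' x := by
  have h := integral_sawBernoulli_mul_Ioi 0 hN1 hu hu' hN hN'
  simp only [sawBernoulli, bernoulliFun_zero, Complex.ofReal_one, one_mul, zero_add,
    bernoulliFun_one, Nat.cast_zero, div_one] at h
  rw [h]
  have hs : ∑' n : ℕ, u ((n : ℝ) + 1) = ∑ n ∈ Finset.range N, u ((n : ℝ) + 1) := by
    refine tsum_eq_sum (fun n hn => hN _ ?_)
    have : N ≤ n := by simpa using hn
    have : (N : ℝ) ≤ n := by exact_mod_cast this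
    linarith
  have h1 : ∑ n ∈ Finset.range N, u ((n : ℝ) + 1) = u 1 + ∑ n ∈ Finset.Ico 1 N, u ((n : ℝ) + 1) := by
    rw [Finset.range_eq_Ico, Finset.sum_eq_sum_Ico_succ_bot (by omega)]
    simp
  have h2 := Finset.sum_Ico_sub (fun n : ℕ => u n) hN1
  push_cast at h2
  rw [hN N le_rfl, Finset.sum_sub_distrib] at h2
  rw [hs, h1, Finset.sum_sub_distrib, ← Finset.mul_sum, ← Finset.mul_sum]
  simp only [sawBernoulli, bernoulliFun_one]
  push_cast
  linear_combination (1 / 2 : ℂ) * h2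

/-! ### The family x^(-z) φ(xh) and its remainder integrals -/

/-- The function `x ↦ x ^ (-z) φ (x h)`. -/
noncomputable def cutPow (φ : ℝ → ℝ) (h : ℝ) (z : ℂ) (x : ℝ) : ℂ :=
  (x : ℂ) ^ (-z) * (φ (x * h) : ℂ)

/-- The Euler operator `φ ↦ y φ'(y)`. -/
noncomputable def eulerOp (φ : ℝ → ℝ) (y : ℝ) : ℝ := y * deriv φ y

theorem HasCompactSupport.eulerOp {φ : ℝ → ℝ} (hφ : HasCompactSupport φ) :
    HasCompactSupport (eulerOp φ) :=
  hφ.deriv.mul_left (f := fun y : ℝ => y)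

theorem ContDiff.eulerOp {φ : ℝ → ℝ} {m : ℕ} (hφ : ContDiff ℝ (m + 1 : ℕ) φ) :
    ContDiff ℝ m (eulerOp φ) := by
  have : ContDiff ℝ m (deriv φ) := ContDiff.deriv' (by exact_mod_cast hφ)
  exact contDiff_id.mul this

theorem HasCompactSupport.eventually_atTop_comp_mul_eq_zero {φ : ℝ → ℝ} (hφ : HasCompactSupport φ)
    {h : ℝ} (hh : 0 < h) : ∀ᶠ x : ℝ in atTop, φ (x * h) = 0 := by
  have h1 : ∀ᶠ y : ℝ in atTop, φ y = 0 := by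
    have := hasCompactSupport_iff_eventuallyEq.mp hφ
    rw [coclosedCompact_eq_cocompact] at this
    exact this.filter_mono atTop_le_cocompact
  exact (tendsto_id.atTop_mul_const hh).eventually h1

theorem Filter.Eventually.exists_nat_forall_ge {P : ℝ → Prop} (hP : ∀ᶠ x in atTop, P x) :
    ∃ N : ℕ, 1 ≤ N ∧ ∀ x, (N : ℝ) ≤ x → P x := by
  obtain ⟨a, ha⟩ := eventually_atTop.mp hP
  obtain ⟨N, hN⟩ := exists_nat_ge a
  refine ⟨N + 1, by omega, fun x hx => ha x ?_⟩
  push_cast at hx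
  linarith

theorem cutPow_zero_of {φ : ℝ → ℝ} {h : ℝ} {z : ℂ} {x : ℝ} (hx : φ (x * h) = 0) :
    cutPow φ h z x = 0 := by simp [cutPow, hx]

theorem continuousOn_cutPow {φ : ℝ → ℝ} (hφ : Continuous φ) (h : ℝ) (z : ℂ) :
    ContinuousOn (cutPow φ h z) (Ioi 0) := by
  intro x hx
  refine ContinuousAt.continuousWithinAt (ContinuousAt.mul ?_ ?_)
  · exact Complex.continuousAt_ofReal_cpow_const _ _ (Or.inr (ne_of_gt hx))
  · exact (Complex.continuous_ofReal.comp (hφ.comp (continuous_mul_const h))).continuousAt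

theorem Ici_one_subset_Ioi_zero : Ici (1 : ℝ) ⊆ Ioi 0 := fun _ hx => mem_Ioi.mpr (one_pos.trans_le (mem_Ici.mp hx))

theorem integrableOn_cutPow {φ : ℝ → ℝ} (hφ : Continuous φ) (hs : HasCompactSupport φ) {h : ℝ}
    (hh : 0 < h) (z : ℂ) : IntegrableOn (cutPow φ h z) (Ioi 1) := by
  obtain ⟨N, -, hN⟩ := (hs.eventually_atTop_comp_mul_eq_zero hh).exists_nat_forall_ge
  exact integrableOn_Ioi_of_eq_zero_of_le
    ((continuousOn_cutPow hφ h z).mono Ici_one_subset_Ioi_zero) (fun x hx => cutPow_zero_of (hN x hx))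

/-- Since y d/dy commutes with dilations, the chain-rule factor h is absorbed into `eulerOp φ` at
the price of one power of x. The family is thus closed under differentiation with coefficients free
of h. -/
theorem hasDerivAt_cutPow {φ : ℝ → ℝ} (hφ : Differentiable ℝ φ) (h : ℝ) (z : ℂ) {x : ℝ}
    (hx : 0 < x) : HasDerivAt (cutPow φ h z)
      (cutPow (eulerOp φ) h (z + 1) x - z * cutPow φ h (z + 1) x) x := by
  have hx0 : (x : ℂ) ≠ 0 := by exact_mod_cast hx.ne'
  have h1 : HasDerivAt (fun y : ℝ => (y : ℂ) ^ (-z)) (-z * (x : ℂ) ^ (-z - 1)) x := by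
    have := ((hasDerivAt_id (x : ℂ)).cpow_const (c := -z)
      (Complex.ofReal_mem_slitPlane.mpr hx)).comp_ofReal
    simpa using this
  have h2 : HasDerivAt (fun y : ℝ => ((φ (y * h) : ℝ) : ℂ)) ((deriv φ (x * h) * h : ℝ) : ℂ) x := by
    have := ((hφ (x * h)).hasDerivAt.comp x ((hasDerivAt_id x).mul_const h)).ofReal_comp
    simpa [Function.comp_def] using this
  convert! h1.mul h2 using 1
  simp only [cutPow, eulerOp]
  have e : (x : ℂ) ^ (-z) = (x : ℂ) ^ (-(z + 1)) * x := by
    nth_rw 3 [← Complex.cpow_one (x : ℂ)]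
    rw [← Complex.cpow_add _ _ hx0]
    congr 1; ring
  rw [e, show -z - 1 = -(z + 1) by ring]
  push_cast
  ring

/-- The Euler–Maclaurin remainder integral of `x ^ (-z) φ (x h)`. -/
noncomputable def sawIntegral (k : ℕ) (φ : ℝ → ℝ) (h : ℝ) (z : ℂ) : ℂ :=
  ∫ x in Ioi (1 : ℝ), (sawBernoulli k x : ℂ) * cutPow φ h z x

theorem integral_sawBernoulli_mul_deriv_cutPow (k : ℕ) {φ : ℝ → ℝ} (hφ : ContDiff ℝ 1 φ)
    (hs : HasCompactSupport φ) {h : ℝ} (hh : 0 < h) (z : ℂ) :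
    ∫ x in Ioi (1 : ℝ), (sawBernoulli k x : ℂ) *
      (cutPow (eulerOp φ) h (z + 1) x - z * cutPow φ h (z + 1) x) =
    sawIntegral k (eulerOp φ) h (z + 1) - z * sawIntegral k φ h (z + 1) := by
  have hE : Continuous (eulerOp φ) := (ContDiff.eulerOp (m := 0) (by simpa using hφ)).continuous
  have i1 := (integrableOn_cutPow hE hs.eulerOp hh (z + 1)).sawBernoulli_mul k
  have i2 := (integrableOn_cutPow hφ.continuous hs hh (z + 1)).sawBernoulli_mul k
  simp only [sawIntegral]
  rw [← integral_const_mul, ← integral_sub i1 (i2.const_mul z)]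
  exact integral_congr_ae (Eventually.of_forall (fun x => by simp only []; ring))

theorem continuousOn_deriv_cutPow {φ : ℝ → ℝ} (hφ : ContDiff ℝ 1 φ) (h : ℝ) (z : ℂ) :
    ContinuousOn (fun x => cutPow (eulerOp φ) h (z + 1) x - z * cutPow φ h (z + 1) x) (Ici 1) := by
  have hE : Continuous (eulerOp φ) := (ContDiff.eulerOp (m := 0) (by simpa using hφ)).continuous
  exact ((continuousOn_cutPow hE h _).sub
    ((continuousOn_cutPow hφ.continuous h _).const_mul z)).mono Ici_one_subset_Ioi_zero

/-- One derivative of φ buys one more power of decay: z becomes z + 1, and the boundary term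
converges as h → 0. -/
theorem sawIntegral_step {k : ℕ} (hk : k ≠ 0) {φ : ℝ → ℝ} (hφ : ContDiff ℝ 1 φ)
    (hs : HasCompactSupport φ) {h : ℝ} (hh : 0 < h) (z : ℂ) :
    sawIntegral k φ h z = -((bernoulliFun (k + 1) 0 : ℂ) / (k + 1)) * (φ h : ℂ)
      - 1 / (k + 1) * (sawIntegral (k + 1) (eulerOp φ) h (z + 1)
        - z * sawIntegral (k + 1) φ h (z + 1)) := by
  obtain ⟨N, hN1, hN⟩ := ((hs.eventually_atTop_comp_mul_eq_zero hh).and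
    (hs.eulerOp.eventually_atTop_comp_mul_eq_zero hh)).exists_nat_forall_ge
  rw [← integral_sawBernoulli_mul_deriv_cutPow (k + 1) hφ hs hh, sawIntegral,
    integral_sawBernoulli_mul_Ioi_of_pos hk hN1
      (fun x hx => hasDerivAt_cutPow (hφ.differentiable one_ne_zero) h z (one_pos.trans_le hx))
      (continuousOn_deriv_cutPow hφ h z) (fun x hx => cutPow_zero_of (hN x hx).1)
      (fun x hx => by rw [cutPow_zero_of (hN x hx).1, cutPow_zero_of (hN x hx).2]; simp)]
  simp [cutPow]

theorem tsum_cutPow_sub_integral {φ : ℝ → ℝ} (hφ : ContDiff ℝ 1 φ)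
    (hs : HasCompactSupport φ) {h : ℝ} (hh : 0 < h) (z : ℂ) :
    ∑' n : ℕ, cutPow φ h z ((n : ℝ) + 1) - ∫ x in Ioi (1 : ℝ), cutPow φ h z x =
      (φ h : ℂ) / 2 + (sawIntegral 1 (eulerOp φ) h (z + 1) - z * sawIntegral 1 φ h (z + 1)) := by
  obtain ⟨N, hN1, hN⟩ := ((hs.eventually_atTop_comp_mul_eq_zero hh).and
    (hs.eulerOp.eventually_atTop_comp_mul_eq_zero hh)).exists_nat_forall_ge
  rw [← integral_sawBernoulli_mul_deriv_cutPow 1 hφ hs hh, sum_sub_integral_Ioi_one hN1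
      (fun x hx => hasDerivAt_cutPow (hφ.differentiable one_ne_zero) h z (one_pos.trans_le hx))
      (continuousOn_deriv_cutPow hφ h z) (fun x hx => cutPow_zero_of (hN x hx).1)
      (fun x hx => by rw [cutPow_zero_of (hN x hx).1, cutPow_zero_of (hN x hx).2]; simp)]
  simp [cutPow]

/-! ### Locally uniform convergence in z as h → 0 -/

/-- A continuous multiplier is locally bounded. This serves for the factor z produced by
differentiating x^(-z). -/
theorem TendstoLocallyUniformlyOn.const_smul_of_continuous {ι : Type*} {F : ι → ℂ → ℂ} {G : ℂ → ℂ}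
    {l : Filter ι} {s : Set ℂ} (hF : TendstoLocallyUniformlyOn F G l s) {c : ℂ → ℂ}
    (hc : Continuous c) :
    TendstoLocallyUniformlyOn (fun i z => c z * F i z) (fun z => c z * G z) l s := by
  rw [Metric.tendstoLocallyUniformlyOn_iff] at hF ⊢
  intro ε hε x hx
  have hM : 0 < ‖c x‖ + 1 := by positivity
  obtain ⟨t, ht, H⟩ := hF (ε / (‖c x‖ + 1)) (by positivity) x hx
  have ht2 : {y | ‖c y‖ < ‖c x‖ + 1} ∈ 𝓝 x :=
    hc.norm.continuousAt.eventually_lt continuousAt_const (by simp)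
  refine ⟨t ∩ {y | ‖c y‖ < ‖c x‖ + 1}, inter_mem ht (mem_nhdsWithin_of_mem_nhds ht2), ?_⟩
  filter_upwards [H] with i hi y hy
  rw [dist_eq_norm, ← mul_sub, norm_mul, ← dist_eq_norm]
  calc _ ≤ (‖c x‖ + 1) * dist (G y) (F i y) :=
        mul_le_mul_of_nonneg_right (le_of_lt hy.2) dist_nonneg
    _ < (‖c x‖ + 1) * (ε / (‖c x‖ + 1)) := mul_lt_mul_of_pos_left (hi y hy.1) hM
    _ = ε := by field_simp

theorem tendsto_integral_norm_cutoff_sub {φ : ℝ → ℝ} (hφ : Continuous φ)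
    (hs : HasCompactSupport φ) {σ : ℝ} (hσ : 1 < σ) :
    Tendsto (fun h : ℝ => ∫ x in Ioi (1 : ℝ), x ^ (-σ) * |φ (x * h) - φ 0|) (𝓝[>] 0) (𝓝 0) := by
  obtain ⟨C, hC⟩ := hs.exists_bound_of_continuous hφ
  have := tendsto_integral_filter_of_dominated_convergence (μ := volume.restrict (Ioi (1 : ℝ)))
    (l := 𝓝[>] (0 : ℝ)) (F := fun h x => x ^ (-σ) * |φ (x * h) - φ 0|) (f := fun _ => (0 : ℝ))
    (fun x => x ^ (-σ) * (C + C)) ?_ ?_ ?_ ?_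
  · simpa using this
  · refine Eventually.of_forall (fun h => ContinuousOn.aestronglyMeasurable ?_ measurableSet_Ioi)
    refine ContinuousOn.mul ?_ (Continuous.continuousOn (by fun_prop))
    exact fun x hx => (Real.continuousAt_rpow_const _ _
      (Or.inl (one_pos.trans hx).ne')).continuousWithinAt
  · refine Eventually.of_forall (fun h => ?_)
    filter_upwards [ae_restrict_mem measurableSet_Ioi] with x hx
    have hx0 : 0 ≤ x ^ (-σ) := Real.rpow_nonneg (one_pos.trans hx).le _
    rw [Real.norm_of_nonneg (by positivity)]
    refine mul_le_mul_of_nonneg_left ?_ hx0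
    exact (norm_sub_le _ _).trans (add_le_add (hC _) (hC _))
  · exact (integrableOn_Ioi_rpow_of_lt (by linarith) one_pos).mul_const _
  · refine Eventually.of_forall (fun x => ?_)
    have : Continuous (fun h : ℝ => x ^ (-σ) * |φ (x * h) - φ 0|) := by fun_prop
    have := (this.tendsto 0).mono_left (nhdsWithin_le_nhds (s := Ioi 0))
    simpa using this

/-- For x > 1 and Re z > σ > 1 one has |x^(-z)| ≤ x^(-σ), so the error is at most C times the
integral of x^(-σ) |φ(xh) - φ(0)|. This bound does not involve z and tends to 0 by dominated
convergence. -/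
theorem tendstoLocallyUniformlyOn_integral_cutPow {φ : ℝ → ℝ} (hφ : Continuous φ)
    (hs : HasCompactSupport φ) {b : ℝ → ℝ} {C : ℝ} (hb : Measurable b) (hC : ∀ x, |b x| ≤ C) :
    TendstoLocallyUniformlyOn
      (fun h z => ∫ x in Ioi (1 : ℝ), (b x : ℂ) * cutPow φ h z x)
      (fun z => ∫ x in Ioi (1 : ℝ), (b x : ℂ) * ((φ 0 : ℂ) * (x : ℂ) ^ (-z)))
      (𝓝[>] 0) {z | 1 < z.re} := by
  have hC0 : 0 ≤ C := (abs_nonneg _).trans (hC 0)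
  have hbm : ∀ s : Set ℝ, AEStronglyMeasurable (fun x => (b x : ℂ)) (volume.restrict s) :=
    fun s => (Complex.measurable_ofReal.comp hb).aestronglyMeasurable
  have hbd : ∀ x, ‖(b x : ℂ)‖ ≤ C := fun x => by simpa using hC x
  refine tendstoLocallyUniformlyOn_of_forall_exists_nhds (fun w hw => ?_)
  obtain ⟨σ, hσ1, hσw⟩ := exists_between (show (1 : ℝ) < w.re from hw)
  refine ⟨{z | σ < z.re}, mem_nhdsWithin_of_mem_nhds
    ((isOpen_lt continuous_const Complex.continuous_re).mem_nhds hσw), ?_⟩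
  rw [Metric.tendstoUniformlyOn_iff]
  intro ε hε
  have h0 := (tendsto_integral_norm_cutoff_sub hφ hs hσ1).const_mul C
  rw [mul_zero] at h0
  filter_upwards [h0.eventually_lt_const hε, self_mem_nhdsWithin] with h hlt hh z hz
  refine lt_of_le_of_lt ?_ hlt
  have hz1 : (-z).re < -1 := by
    have : σ < z.re := hz
    rw [Complex.neg_re]; linarith
  have i1 : IntegrableOn (fun x : ℝ => (b x : ℂ) * ((φ 0 : ℂ) * (x : ℂ) ^ (-z))) (Ioi 1) :=
    Integrable.bdd_mul (c := C) ((integrableOn_Ioi_cpow_of_lt hz1 one_pos).const_mul _) (hbm _)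
      (Eventually.of_forall hbd)
  have i2 : IntegrableOn (fun x : ℝ => (b x : ℂ) * cutPow φ h z x) (Ioi 1) :=
    Integrable.bdd_mul (c := C) (integrableOn_cutPow hφ hs hh z) (hbm _) (Eventually.of_forall hbd)
  rw [dist_comm, dist_eq_norm, ← integral_sub i2 i1, ← integral_const_mul]
  obtain ⟨D, hD⟩ := hs.exists_bound_of_continuous hφ
  refine norm_integral_le_of_norm_le (Integrable.const_mul ?_ C) ?_
  · refine Integrable.mul_bdd (c := D + D)
      (integrableOn_Ioi_rpow_of_lt (by linarith) one_pos) ?_ (Eventually.of_forall (fun x => ?_))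
    · exact Continuous.aestronglyMeasurable (by fun_prop)
    · rw [Real.norm_eq_abs, abs_abs]
      exact (norm_sub_le _ _).trans (add_le_add (hD _) (hD _))
  · filter_upwards [ae_restrict_mem measurableSet_Ioi] with x hx
    have hx1 : (1 : ℝ) < x := hx
    have hx0 : 0 < x := one_pos.trans hx
    rw [← mul_sub, norm_mul, cutPow, mul_comm (φ 0 : ℂ), ← mul_sub, norm_mul,
      Complex.norm_cpow_eq_rpow_re_of_pos hx0, ← Complex.ofReal_sub, Complex.norm_real,
      Complex.norm_real, Real.norm_eq_abs, Real.norm_eq_abs]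
    refine mul_le_mul (hC x) ?_ (by positivity) hC0
    refine mul_le_mul_of_nonneg_right ?_ (abs_nonneg _)
    refine Real.rpow_le_rpow_of_exponent_le hx1.le ?_
    have : σ < z.re := hz
    rw [Complex.neg_re]; linarith

/-- Induction on the smoothness m: each use of `sawIntegral_step` widens the half-plane by one unit.
The limit is left implicit, since it is identified later by analytic continuation. -/
theorem exists_tendstoLocallyUniformlyOn_sawIntegral (m : ℕ) : ∀ {k : ℕ}, k ≠ 0 → ∀ {φ : ℝ → ℝ},
    ContDiff ℝ m φ → HasCompactSupport φ →
    ∃ G : ℂ → ℂ, TendstoLocallyUniformlyOn (sawIntegral k φ) G (𝓝[>] 0) {z | 1 - m < z.re} := by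
  induction m with
  | zero =>
    intro k _ φ hφ hs
    obtain ⟨C, -, hC⟩ := exists_abs_sawBernoulli_le k
    refine ⟨fun z => ∫ x in Ioi (1 : ℝ), (sawBernoulli k x : ℂ) * ((φ 0 : ℂ) * (x : ℂ) ^ (-z)), ?_⟩
    simpa using! tendstoLocallyUniformlyOn_integral_cutPow hφ.continuous hs
      (measurable_sawBernoulli k) hC
  | succ m ih =>
    intro k hk φ hφ hs
    have hφ1 : ContDiff ℝ 1 φ := hφ.of_le (by exact_mod_cast Nat.le_add_left 1 m)
    obtain ⟨G₁, hG₁⟩ := ih (Nat.succ_ne_zero k) hφ.eulerOp hs.eulerOp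
    obtain ⟨G₂, hG₂⟩ := ih (Nat.succ_ne_zero k) (hφ.of_le (by exact_mod_cast Nat.le_succ m)) hs
    have hmaps : MapsTo (fun z : ℂ => z + 1) {z | 1 - ((m + 1 : ℕ) : ℝ) < z.re}
        {z | 1 - (m : ℝ) < z.re} := by
      intro z hz
      have : 1 - ((m + 1 : ℕ) : ℝ) < z.re := hz
      push_cast at this
      simp only [mem_ofPred_eq, Complex.add_re, Complex.one_re]
      linarith
    have hcont : ContinuousOn (fun z : ℂ => z + 1) {z | 1 - ((m + 1 : ℕ) : ℝ) < z.re} :=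
      Continuous.continuousOn (by fun_prop)
    have h1 := hG₁.comp _ hmaps hcont
    have h2 := (hG₂.comp _ hmaps hcont).const_smul_of_continuous continuous_id
    have h3 := (h1.sub h2).const_smul_of_continuous
      (continuous_const (y := (1 : ℂ) / (k + 1)))
    have h0 : TendstoLocallyUniformlyOn
        (fun h (_ : ℂ) => -((bernoulliFun (k + 1) 0 : ℂ) / (k + 1)) * (φ h : ℂ))
        (fun _ => -((bernoulliFun (k + 1) 0 : ℂ) / (k + 1)) * (φ 0 : ℂ)) (𝓝[>] 0)
        {z | 1 - ((m + 1 : ℕ) : ℝ) < z.re} := by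
      refine TendstoUniformlyOn.tendstoLocallyUniformlyOn (Tendsto.tendstoUniformlyOn_const ?_ _)
      have : Continuous (fun h => -((bernoulliFun (k + 1) 0 : ℂ) / (k + 1)) * (φ h : ℂ)) :=
        continuous_const.mul (Complex.continuous_ofReal.comp hφ.continuous)
      exact (this.tendsto 0).mono_left nhdsWithin_le_nhds
    refine ⟨_, (h0.sub h3).congr_inseparable ?_⟩
    filter_upwards [self_mem_nhdsWithin] with h hh z hz
    simp only [Pi.sub_apply, Function.comp, id]
    rw [sawIntegral_step hk hφ1 hs hh]

/-- The sum of `n ^ (-z) φ (n h)` over `n ≥ 1`, minus the integral over `(1, ∞)`. -/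
noncomputable def sumSubIntegral (φ : ℝ → ℝ) (h : ℝ) (z : ℂ) : ℂ :=
  ∑' n : ℕ, cutPow φ h z ((n : ℝ) + 1) - ∫ x in Ioi (1 : ℝ), cutPow φ h z x

theorem exists_tendstoLocallyUniformlyOn_sumSubIntegral {m : ℕ} {φ : ℝ → ℝ}
    (hφ : ContDiff ℝ (m + 1 : ℕ) φ) (hs : HasCompactSupport φ) :
    ∃ G : ℂ → ℂ, TendstoLocallyUniformlyOn (sumSubIntegral φ) G (𝓝[>] 0)
      {z | 1 - ((m + 1 : ℕ) : ℝ) < z.re} := by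
  have hφ1 : ContDiff ℝ 1 φ := hφ.of_le (by exact_mod_cast Nat.le_add_left 1 m)
  obtain ⟨G₁, hG₁⟩ := exists_tendstoLocallyUniformlyOn_sawIntegral m one_ne_zero
    hφ.eulerOp hs.eulerOp
  obtain ⟨G₂, hG₂⟩ := exists_tendstoLocallyUniformlyOn_sawIntegral m one_ne_zero
    (hφ.of_le (by exact_mod_cast Nat.le_succ m)) hs
  have hmaps : MapsTo (fun z : ℂ => z + 1) {z | 1 - ((m + 1 : ℕ) : ℝ) < z.re}
      {z | 1 - (m : ℝ) < z.re} := by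
    intro z hz
    have : 1 - ((m + 1 : ℕ) : ℝ) < z.re := hz
    push_cast at this
    simp only [mem_ofPred_eq, Complex.add_re, Complex.one_re]
    linarith
  have hcont : ContinuousOn (fun z : ℂ => z + 1) {z | 1 - ((m + 1 : ℕ) : ℝ) < z.re} :=
    Continuous.continuousOn (by fun_prop)
  have h1 := hG₁.comp _ hmaps hcont
  have h2 := (hG₂.comp _ hmaps hcont).const_smul_of_continuous continuous_id
  have h0 : TendstoLocallyUniformlyOn (fun h (_ : ℂ) => (φ h : ℂ) / 2)
      (fun _ => (φ 0 : ℂ) / 2) (𝓝[>] 0) {z | 1 - ((m + 1 : ℕ) : ℝ) < z.re} := by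
    refine TendstoUniformlyOn.tendstoLocallyUniformlyOn (Tendsto.tendstoUniformlyOn_const ?_ _)
    have : Continuous (fun h => (φ h : ℂ) / 2) :=
      (Complex.continuous_ofReal.comp hφ.continuous).div_const _
    exact (this.tendsto 0).mono_left nhdsWithin_le_nhds
  refine ⟨_, (h0.add (h1.sub h2)).congr_inseparable ?_⟩
  filter_upwards [self_mem_nhdsWithin] with h hh z hz
  rw [sumSubIntegral, tsum_cutPow_sub_integral hφ1 hs hh]
  exact .of_eq rfl

/-! ### Differentiation in the exponent -/

theorem logIntegrand_eq (φ : ℝ → ℝ) (z : ℂ) (h x : ℝ) :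
    logIntegrand φ z h x = -(Real.log x : ℂ) * cutPow φ h z x := by
  rw [logIntegrand, cutPow]; ring

/-- The integral is the Mellin transform at 1 - z of φ(xh) cut off to x > 1. That function vanishes
near 0 and near ∞, so its Mellin transform may be differentiated under the integral at every point.
-/
theorem hasDerivAt_integral_cutPow {φ : ℝ → ℝ} (hφ : Continuous φ) (hs : HasCompactSupport φ)
    {h : ℝ} (hh : 0 < h) (z : ℂ) :
    HasDerivAt (fun z => ∫ x in Ioi (1 : ℝ), cutPow φ h z x)
      (∫ x in Ioi (1 : ℝ), logIntegrand φ z h x) z := by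
  set f : ℝ → ℂ := (Ioi (1 : ℝ)).indicator (fun x => (φ (x * h) : ℂ)) with hf
  have hint : Integrable (fun x => (φ (x * h) : ℂ)) := by
    have h1 : Integrable φ := hφ.integrable_of_hasCompactSupport hs
    exact (h1.comp_mul_right' hh.ne').ofReal
  have hloc : LocallyIntegrableOn f (Ioi 0) :=
    (hint.indicator measurableSet_Ioi).locallyIntegrable.locallyIntegrableOn _
  have htop : f =O[atTop] (fun x : ℝ => x ^ (-((1 - z).re + 1))) := by
    refine EventuallyEq.trans_isBigO ?_ (Asymptotics.isBigO_zero _ _)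
    filter_upwards [hs.eventually_atTop_comp_mul_eq_zero hh] with x hx
    simp [hf, hx, indicator_apply]
  have hbot : f =O[𝓝[>] 0] (fun x : ℝ => x ^ (-((1 - z).re - 1))) := by
    refine EventuallyEq.trans_isBigO ?_ (Asymptotics.isBigO_zero _ _)
    filter_upwards [nhdsWithin_le_nhds (Iio_mem_nhds one_pos)] with x hx
    exact indicator_of_notMem (not_lt.mpr (le_of_lt hx)) _
  have key := (mellin_hasDerivAt_of_isBigO_rpow hloc htop (by linarith) hbot (by linarith)).2
  have hsub : ∀ g : ℝ → ℂ, ∫ x in Ioi (0 : ℝ), (Ioi (1 : ℝ)).indicator g x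
      = ∫ x in Ioi (1 : ℝ), g x := by
    intro g
    rw [setIntegral_indicator measurableSet_Ioi, inter_eq_right.mpr (Ioi_subset_Ioi zero_le_one)]
  have e1 : ∀ w : ℂ, mellin f (1 - w) = ∫ x in Ioi (1 : ℝ), cutPow φ h w x := by
    intro w
    rw [mellin, ← hsub]
    congr 1 with x
    by_cases hx : x ∈ Ioi (1 : ℝ)
    · simp only [hf, indicator_of_mem hx, cutPow, smul_eq_mul]
      congr 2; ring
    · simp [hf, indicator_of_notMem hx]
  have e2 : mellin (fun t => Real.log t • f t) (1 - z) = -∫ x in Ioi (1 : ℝ), logIntegrand φ z h x := by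
    rw [mellin, ← integral_neg, ← hsub]
    congr 1 with x
    by_cases hx : x ∈ Ioi (1 : ℝ)
    · simp only [hf, indicator_of_mem hx, logIntegrand_eq, cutPow, smul_eq_mul, Complex.real_smul]
      rw [show (1 - z - 1 : ℂ) = -z by ring]
      ring
    · simp [hf, indicator_of_notMem hx]
  have hc := key.comp z ((hasDerivAt_id z).const_sub 1)
  rw [e2] at hc
  simp only [Function.comp_def, e1] at hc
  simpa using hc

theorem hasDerivAt_cutPow_exponent (φ : ℝ → ℝ) (h : ℝ) (z : ℂ) {x : ℝ} (hx : 0 < x) :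
    HasDerivAt (fun z => cutPow φ h z x) (logIntegrand φ z h x) z := by
  have hx0 : (x : ℂ) ≠ 0 := by exact_mod_cast hx.ne'
  have := (((hasDerivAt_id z).neg).const_cpow (c := (x : ℂ)) (Or.inl hx0)).mul_const (φ (x * h) : ℂ)
  convert! this using 1
  rw [logIntegrand, Complex.ofReal_log hx.le]
  simp

theorem hasDerivAt_tsum_cutPow {φ : ℝ → ℝ} (hs : HasCompactSupport φ)
    {h : ℝ} (hh : 0 < h) (z : ℂ) :
    HasDerivAt (fun z => ∑' n : ℕ, cutPow φ h z ((n : ℝ) + 1)) (logSum φ z h) z := by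
  obtain ⟨N, -, hN⟩ := (hs.eventually_atTop_comp_mul_eq_zero hh).exists_nat_forall_ge
  have hz : ∀ n ∉ Finset.range N, φ (((n : ℝ) + 1) * h) = 0 := by
    intro n hn
    have : N ≤ n := by simpa using hn
    have : (N : ℝ) ≤ n := by exact_mod_cast this
    exact hN _ (by linarith)
  have e1 : (fun z => ∑' n : ℕ, cutPow φ h z ((n : ℝ) + 1))
      = fun z => ∑ n ∈ Finset.range N, cutPow φ h z ((n : ℝ) + 1) := by
    ext w
    exact tsum_eq_sum (fun n hn => cutPow_zero_of (hz n hn))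
  rw [e1, logSum, tsum_eq_sum (s := Finset.range N)
    (fun n hn => by rw [logIntegrand_eq, cutPow_zero_of (hz n hn), mul_zero])]
  exact HasDerivAt.fun_sum (fun n _ => hasDerivAt_cutPow_exponent φ h z (by positivity))

theorem hasDerivAt_sumSubIntegral {φ : ℝ → ℝ} (hφ : Continuous φ) (hs : HasCompactSupport φ)
    {h : ℝ} (hh : 0 < h) (z : ℂ) :
    HasDerivAt (sumSubIntegral φ h) (logSum φ z h - ∫ x in Ioi (1 : ℝ), logIntegrand φ z h x) z :=
  (hasDerivAt_tsum_cutPow hs hh z).sub (hasDerivAt_integral_cutPow hφ hs hh z)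

/-! ### Identification of the limit with ζ -/

theorem tendsto_sumSubIntegral_of_one_lt_re {φ : ℝ → ℝ} (hφ : Continuous φ)
    (hs : HasCompactSupport φ) (h0 : φ 0 = 1) {z : ℂ} (hz : 1 < z.re) :
    Tendsto (fun h => sumSubIntegral φ h z) (𝓝[>] 0) (𝓝 (riemannZeta z - 1 / (z - 1))) := by
  obtain ⟨D, hD⟩ := hs.exists_bound_of_continuous hφ
  have hlim : ∀ x : ℝ, Tendsto (fun h => cutPow φ h z x) (𝓝[>] 0) (𝓝 ((x : ℂ) ^ (-z))) := by
    intro x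
    have : Continuous (fun h : ℝ => cutPow φ h z x) :=
      continuous_const.mul (Complex.continuous_ofReal.comp (hφ.comp (continuous_const_mul x)))
    have := (this.tendsto 0).mono_left (nhdsWithin_le_nhds (s := Ioi 0))
    simpa [cutPow, h0] using this
  refine Tendsto.sub ?_ ?_
  · have hsum := (Complex.summable_one_div_nat_cpow (p := z)).mpr hz
    have hsum1 := ((summable_nat_add_iff 1).mpr hsum).norm.mul_right D
    have := tendsto_tsum_of_dominated_convergence (𝓕 := 𝓝[>] (0 : ℝ))
      (f := fun h (n : ℕ) => cutPow φ h z ((n : ℝ) + 1))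
      (g := fun n : ℕ => (((n : ℝ) + 1 : ℝ) : ℂ) ^ (-z)) hsum1 (fun n => hlim _) ?_
    · rw [zeta_eq_tsum_one_div_nat_add_one_cpow hz]
      simpa only [Complex.cpow_neg, one_div, Complex.ofReal_add, Complex.ofReal_natCast,
        Complex.ofReal_one] using this
    · refine Eventually.of_forall (fun h n => ?_)
      rw [cutPow, norm_mul]
      have e : (((n : ℝ) + 1 : ℝ) : ℂ) ^ (-z) = 1 / (((n + 1 : ℕ) : ℂ) ^ z) := by
        rw [Complex.cpow_neg, one_div]; push_cast; rfl
      rw [e]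
      refine mul_le_mul_of_nonneg_left ?_ (norm_nonneg _)
      simpa using hD _
  · have := ((tendstoLocallyUniformlyOn_integral_cutPow hφ hs (b := fun _ => 1) (C := 1)
      measurable_const (by simp)).tendsto_at (show z ∈ {z : ℂ | 1 < z.re} from hz))
    have hz1 : (-z).re < -1 := by rw [Complex.neg_re]; linarith
    have e : -z + 1 = -(z - 1) := by ring
    have e' : -(1 - z)⁻¹ = (z - 1)⁻¹ := by rw [← inv_neg, neg_sub]
    simpa [h0, integral_Ioi_cpow_of_lt hz1 one_pos, e, div_neg, neg_div, e'] using this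

/-- Clearing the pole gives an entire function, so the identity theorem can be applied on a
half-plane containing 1 without puncturing it. -/
theorem differentiable_update_sub_one_mul_riemannZeta :
    Differentiable ℂ (Function.update (fun s => (s - 1) * riemannZeta s) 1 1) := by
  intro s
  rcases eq_or_ne s 1 with rfl | hs
  · refine (Complex.analyticAt_of_differentiable_on_punctured_nhds_of_continuousAt ?_
      (by simpa only [continuousAt_update_same] using riemannZeta_residue_one)).differentiableAt
    filter_upwards [self_mem_nhdsWithin] with t ht
    refine DifferentiableAt.congr_of_eventuallyEq (f := fun s => (s - 1) * riemannZeta s)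
      ((differentiableAt_id.sub_const 1).mul (differentiableAt_riemannZeta ht)) ?_
    filter_upwards [isOpen_ne.mem_nhds ht] with u hu
    exact Function.update_of_ne hu _ _
  · refine DifferentiableAt.congr_of_eventuallyEq (f := fun s => (s - 1) * riemannZeta s)
      ((differentiableAt_id.sub_const 1).mul (differentiableAt_riemannZeta hs)) ?_
    filter_upwards [isOpen_ne.mem_nhds hs] with u hu
    exact Function.update_of_ne hu _ _

theorem tendsto_logSum_sub_integral_Ioi_one {m : ℕ} {φ : ℝ → ℝ}
    (hφ : ContDiff ℝ (m + 1 : ℕ) φ) (hs : HasCompactSupport φ) (h0 : φ 0 = 1) {z : ℂ}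
    (hz : 1 - ((m + 1 : ℕ) : ℝ) < z.re) (hz1 : z ≠ 1) :
    Tendsto (fun h => logSum φ z h - ∫ x in Ioi (1 : ℝ), logIntegrand φ z h x) (𝓝[>] 0)
      (𝓝 (deriv riemannZeta z + 1 / (z - 1) ^ 2)) := by
  obtain ⟨G, hG⟩ := exists_tendstoLocallyUniformlyOn_sumSubIntegral hφ hs
  set U : Set ℂ := {z | 1 - ((m + 1 : ℕ) : ℝ) < z.re} with hU
  have hUo : IsOpen U := isOpen_lt continuous_const Complex.continuous_re
  have hUc : IsPreconnected U := (convex_halfSpace_re_gt (1 - ((m + 1 : ℕ) : ℝ))).isPreconnected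
  have hd : ∀ᶠ h in 𝓝[>] (0 : ℝ), DifferentiableOn ℂ (sumSubIntegral φ h) U := by
    filter_upwards [self_mem_nhdsWithin] with h hh z _
    exact (hasDerivAt_sumSubIntegral hφ.continuous hs hh z).differentiableAt.differentiableWithinAt
  have hGd : DifferentiableOn ℂ G U := hG.differentiableOn hd hUo
  have hGζ : ∀ w, 1 < w.re → G w = riemannZeta w - 1 / (w - 1) := by
    intro w hw
    refine tendsto_nhds_unique (hG.tendsto_at (show w ∈ U from ?_))
      (tendsto_sumSubIntegral_of_one_lt_re hφ.continuous hs h0 hw)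
    have : (0 : ℝ) ≤ m := by positivity
    simp only [hU, mem_ofPred_eq]; push_cast; linarith
  -- The factor w - 1 makes both sides holomorphic across w = 1. They agree for Re w > 1, hence on
  -- the connected set U.
  have hEq : EqOn (fun w => (w - 1) * G w + 1)
      (Function.update (fun s => (s - 1) * riemannZeta s) 1 1) U := by
    have h2 : (2 : ℂ) ∈ U := by
      have : (0 : ℝ) ≤ m := by positivity
      simp only [hU, mem_ofPred_eq]; push_cast; norm_num; linarith
    refine AnalyticOnNhd.eqOn_of_preconnected_of_eventuallyEq (𝕜 := ℂ) (z₀ := 2) ?_ ?_ hUc h2 ?_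
    · refine DifferentiableOn.analyticOnNhd ?_ hUo
      exact ((differentiableOn_id.sub_const 1).mul hGd).add_const 1
    · exact (differentiable_update_sub_one_mul_riemannZeta.differentiableOn).analyticOnNhd hUo
    · have : {w : ℂ | 1 < w.re} ∈ 𝓝 (2 : ℂ) :=
        (isOpen_lt continuous_const Complex.continuous_re).mem_nhds (by simp)
      filter_upwards [this] with w hw
      have hw1 : w ≠ 1 := by rintro rfl; simp at hw
      rw [Function.update_of_ne hw1, hGζ w hw]
      field_simp [sub_ne_zero.mpr hw1]
      ring
  have hGz : G =ᶠ[𝓝 z] fun w => riemannZeta w - 1 / (w - 1) := by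
    filter_upwards [hUo.mem_nhds hz, isOpen_ne.mem_nhds hz1] with w hw hw1
    have := hEq hw
    simp only [Function.update_of_ne hw1] at this
    have hne : w - 1 ≠ 0 := sub_ne_zero.mpr hw1
    field_simp
    linear_combination this
  have hderiv : deriv G z = deriv riemannZeta z + 1 / (z - 1) ^ 2 := by
    rw [hGz.deriv_eq]
    have h1 := (differentiableAt_riemannZeta hz1).hasDerivAt
    have h2 := ((hasDerivAt_id z).sub_const 1).inv (sub_ne_zero.mpr hz1)
    have h3 := (h1.sub h2).deriv
    simp only [one_div]
    refine Eq.trans h3 ?_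
    simp [neg_div]
  rw [← hderiv]
  -- Weierstrass: locally uniform convergence of holomorphic functions carries over to their
  -- derivatives.
  refine ((hG.deriv hd hUo).tendsto_at hz).congr' ?_
  filter_upwards [self_mem_nhdsWithin] with h hh
  exact (hasDerivAt_sumSubIntegral hφ.continuous hs hh z).deriv

/-! ### Finite parts and the logarithmic moments on (0, 1] -/

theorem HasFinitePart.congr {f g : ℝ → ℂ} {L : ℂ} (hf : HasFinitePart f L)
    (hfg : ∀ x, 0 < x → f x = g x) : HasFinitePart g L := by
  have hE : ∀ ε : ℝ, 0 < ε → EqOn f g (Ioi ε) := fun ε hε x hx => hfg x (hε.trans hx)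
  obtain ⟨hi, S, c, hS, hc⟩ := hf
  refine ⟨fun ε hε => (hi ε hε).congr_fun (hE ε hε) measurableSet_Ioi, S, c, hS, hc.congr' ?_⟩
  filter_upwards [self_mem_nhdsWithin] with ε hε
  rw [setIntegral_congr_fun measurableSet_Ioi (hE ε hε)]

theorem HasFinitePart.const_mul {f : ℝ → ℂ} {L : ℂ} (hf : HasFinitePart f L) (a : ℂ) :
    HasFinitePart (fun x => a * f x) (a * L) := by
  obtain ⟨hi, S, c, hS, hc⟩ := hf
  refine ⟨fun ε hε => (hi ε hε).const_mul a, S, fun q => a * c q, hS, (hc.const_mul a).congr ?_⟩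
  intro ε
  rw [integral_const_mul, mul_sub, Finset.mul_sum]
  simp only [mul_assoc]

theorem HasFinitePart.add {f g : ℝ → ℂ} {L M : ℂ} (hf : HasFinitePart f L)
    (hg : HasFinitePart g M) : HasFinitePart (fun x => f x + g x) (L + M) := by
  classical
  obtain ⟨hi, S, c, hS, hc⟩ := hf
  obtain ⟨hi', S', c', hS', hc'⟩ := hg
  refine ⟨fun ε hε => (hi ε hε).add (hi' ε hε), S ∪ S',
    fun q => (if q ∈ S then c q else 0) + (if q ∈ S' then c' q else 0), ?_, ?_⟩
  · intro q hq
    rcases Finset.mem_union.mp hq with h | h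
    · exact hS q h
    · exact hS' q h
  · refine (hc.add hc').congr' ?_
    filter_upwards [self_mem_nhdsWithin] with ε hε
    rw [integral_add (hi ε hε) (hi' ε hε)]
    simp only [add_mul, ite_mul, zero_mul, Finset.sum_add_distrib, Finset.sum_ite_mem,
      Finset.union_inter_cancel_left, Finset.union_inter_cancel_right]
    ring

theorem hasFinitePart_zero : HasFinitePart (fun _ => 0) 0 :=
  ⟨fun _ _ => integrableOn_zero, ∅, 0, by simp, by simp⟩

theorem HasFinitePart.sum {ι : Type*} {s : Finset ι} {f : ι → ℝ → ℂ} {L : ι → ℂ}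
    (hf : ∀ i ∈ s, HasFinitePart (f i) (L i)) :
    HasFinitePart (fun x => ∑ i ∈ s, f i x) (∑ i ∈ s, L i) := by
  classical
  induction s using Finset.induction_on with
  | empty => simpa using hasFinitePart_zero
  | insert a s ha ih =>
    simp only [Finset.sum_insert ha]
    exact (hf a (Finset.mem_insert_self _ _)).add
      (ih (fun i hi => hf i (Finset.mem_insert_of_mem hi)))

theorem continuousAt_cpow_mul_log (s : ℂ) {x : ℝ} (hx : 0 < x) :
    ContinuousAt (fun x : ℝ => (x : ℂ) ^ s * (Real.log x : ℂ)) x :=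
  (Complex.continuousAt_ofReal_cpow_const _ _ (Or.inr hx.ne')).mul
    (Complex.continuous_ofReal.continuousAt.comp (Real.continuousAt_log hx.ne'))

theorem setIntegral_Ioi_indicator_Ioc {f F : ℝ → ℂ}
    (hF : ∀ x, 0 < x → HasDerivAt F (f x) x) (hf : ∀ x, 0 < x → ContinuousAt f x) {ε : ℝ}
    (hε : 0 < ε) (hε1 : ε ≤ 1) :
    ∫ x in Ioi ε, (Ioc (0 : ℝ) 1).indicator f x = F 1 - F ε := by
  rw [setIntegral_indicator measurableSet_Ioc]
  have : Ioi ε ∩ Ioc 0 1 = Ioc ε 1 := by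
    ext x
    simp only [mem_inter_iff, mem_Ioi, mem_Ioc]
    exact ⟨fun h => ⟨h.1, h.2.2⟩, fun h => ⟨h.1, hε.trans h.1, h.2⟩⟩
  rw [this, ← intervalIntegral.integral_of_le hε1]
  have hpos : ∀ x ∈ uIcc ε 1, 0 < x := fun x hx => by
    rw [uIcc_of_le hε1] at hx
    exact hε.trans_le hx.1
  refine intervalIntegral.integral_eq_sub_of_hasDerivAt (fun x hx => hF x (hpos x hx)) ?_
  exact ContinuousOn.intervalIntegrable (fun x hx => (hf x (hpos x hx)).continuousWithinAt)

theorem integrableOn_Ioi_indicator_Ioc {f : ℝ → ℂ} (hf : ∀ x, 0 < x → ContinuousAt f x) {ε : ℝ}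
    (hε : 0 < ε) : IntegrableOn ((Ioc (0 : ℝ) 1).indicator f) (Ioi ε) := by
  rw [IntegrableOn, integrable_indicator_iff measurableSet_Ioc, IntegrableOn,
    Measure.restrict_restrict measurableSet_Ioc]
  refine IntegrableOn.mono_set (t := Icc ε 1) ?_ (fun x hx => ⟨le_of_lt hx.2, hx.1.2⟩)
  exact ContinuousOn.integrableOn_compact isCompact_Icc
    (fun x hx => (hf x (hε.trans_le hx.1)).continuousWithinAt)

/-- The finite part of the integral of `x ^ (s - 1) log x` over `(0, 1)`. -/
noncomputable def logMoment (s : ℂ) : ℂ := if s = 0 then 0 else -(1 / s ^ 2)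

theorem hasDerivAt_cpow_mul_log_primitive {s : ℂ} (hs : s ≠ 0) {x : ℝ} (hx : 0 < x) :
    HasDerivAt (fun x : ℝ => (x : ℂ) ^ s * (Real.log x : ℂ) / s - (x : ℂ) ^ s / s ^ 2)
      ((x : ℂ) ^ (s - 1) * (Real.log x : ℂ)) x := by
  have hx0 : (x : ℂ) ≠ 0 := by exact_mod_cast hx.ne'
  have h1 := hasDerivAt_ofReal_cpow_const hx.ne' hs
  have h2 := (Real.hasDerivAt_log hx.ne').ofReal_comp
  have h3 := ((h1.mul h2).div_const s).sub (h1.div_const (s ^ 2))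
  convert! h3 using 1
  have e : (x : ℂ) ^ s = (x : ℂ) ^ (s - 1) * x := by
    rw [Complex.cpow_sub _ _ hx0, Complex.cpow_one, div_mul_cancel₀ _ hx0]
  rw [e]
  push_cast
  field_simp
  ring

theorem hasFinitePart_indicator_cpow_mul_log (s : ℂ) :
    HasFinitePart ((Ioc (0 : ℝ) 1).indicator (fun x => (x : ℂ) ^ (s - 1) * (Real.log x : ℂ)))
      (logMoment s) := by
  refine ⟨fun ε hε => integrableOn_Ioi_indicator_Ioc
    (fun x hx => continuousAt_cpow_mul_log _ hx) hε, ?_⟩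
  have hev : ∀ᶠ ε : ℝ in 𝓝[>] 0, 0 < ε ∧ ε ≤ 1 := by
    filter_upwards [self_mem_nhdsWithin, nhdsWithin_le_nhds (Iio_mem_nhds one_pos)] with ε h1 h2
    exact ⟨h1, le_of_lt h2⟩
  rcases eq_or_ne s 0 with rfl | hs
  -- The integral of log x / x over (ε, 1) is exactly -(log ε)^2 / 2, so nothing remains after the
  -- subtraction.
  · refine ⟨{(0, 2)}, fun _ => -1 / 2, by simp, ?_⟩
    refine tendsto_const_nhds.congr' ?_
    filter_upwards [hev] with ε hε
    have hF : ∀ x : ℝ, 0 < x → HasDerivAt (fun x : ℝ => (Real.log x : ℂ) ^ 2 / 2)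
        ((x : ℂ) ^ ((0 : ℂ) - 1) * (Real.log x : ℂ)) x := by
      intro x hx
      have h2 := ((Real.hasDerivAt_log hx.ne').ofReal_comp.pow 2).div_const 2
      convert! h2 using 1
      rw [zero_sub, Complex.cpow_neg_one]
      push_cast
      ring
    rw [setIntegral_Ioi_indicator_Ioc hF (fun x hx => continuousAt_cpow_mul_log _ hx) hε.1 hε.2]
    simp [logMoment]
    ring
  · have hint : ∀ᶠ ε : ℝ in 𝓝[>] 0, ∫ x in Ioi ε, (Ioc (0 : ℝ) 1).indicator
        (fun x => (x : ℂ) ^ (s - 1) * (Real.log x : ℂ)) x =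
        -(1 / s ^ 2) - ((ε : ℂ) ^ s * (Real.log ε : ℂ) / s - (ε : ℂ) ^ s / s ^ 2) := by
      filter_upwards [hev] with ε hε
      rw [setIntegral_Ioi_indicator_Ioc (fun x hx => hasDerivAt_cpow_mul_log_primitive hs hx)
        (fun x hx => continuousAt_cpow_mul_log _ hx) hε.1 hε.2]
      simp
    rw [logMoment, if_neg hs]
    -- For Re s = 0, s ≠ 0, the power ε^s oscillates without limit, so this line belongs to the case
    -- where the terms at ε are subtracted. For Re s > 0 they vanish in the limit.
    rcases le_or_gt s.re 0 with hre | hre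
    · refine ⟨{(s, 0), (s, 1)}, fun q => if q.2 = 0 then 1 / s ^ 2 else -(1 / s), ?_, ?_⟩
      · simp [hre, hs]
      · refine tendsto_const_nhds.congr' ?_
        filter_upwards [hint] with ε hε
        rw [hε, Finset.sum_pair (by simp)]
        simp
        ring
    · refine ⟨∅, 0, by simp, ?_⟩
      have h1 : Tendsto (fun ε : ℝ => (ε : ℂ) ^ s) (𝓝[>] 0) (𝓝 0) := by
        rw [tendsto_zero_iff_norm_tendsto_zero]
        have h2 : Tendsto (fun ε : ℝ => ε ^ s.re) (𝓝[>] 0) (𝓝 0) := by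
          have := (Real.continuousAt_rpow_const 0 s.re (Or.inr hre.le)).tendsto
          rw [Real.zero_rpow hre.ne'] at this
          exact this.mono_left nhdsWithin_le_nhds
        refine h2.congr' ?_
        filter_upwards [hev] with ε hε
        rw [Complex.norm_cpow_eq_rpow_re_of_pos hε.1]
      have h2 : Tendsto (fun ε : ℝ => (ε : ℂ) ^ s * (Real.log ε : ℂ)) (𝓝[>] 0) (𝓝 0) := by
        rw [tendsto_zero_iff_norm_tendsto_zero]
        have h3 := (tendsto_log_mul_rpow_nhdsGT_zero hre).norm
        rw [norm_zero] at h3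
        refine h3.congr' ?_
        filter_upwards [hev] with ε hε
        rw [norm_mul, norm_mul, Complex.norm_cpow_eq_rpow_re_of_pos hε.1, mul_comm,
          Complex.norm_real, Real.norm_of_nonneg (Real.rpow_nonneg hε.1.le _)]
      have h3 := ((h2.div_const s).sub (h1.div_const (s ^ 2))).const_sub (-(1 / s ^ 2))
      simp only [zero_div, sub_zero] at h3
      refine h3.congr' ?_
      filter_upwards [hint] with ε hε
      rw [hε]
      simp

/-- This is the integrability half of the differentiability of a Mellin transform, applied to the
indicator of (0, 1]. -/
theorem integrableOn_Ioc_cpow_mul_log {s : ℂ} (hs : 0 < s.re) :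
    IntegrableOn (fun x : ℝ => (x : ℂ) ^ (s - 1) * (Real.log x : ℂ)) (Ioc 0 1) := by
  have hloc : LocallyIntegrableOn ((Ioc (0 : ℝ) 1).indicator (fun _ => (1 : ℂ))) (Ioi 0) := by
    refine LocallyIntegrable.locallyIntegrableOn (Integrable.locallyIntegrable ?_) _
    exact (integrable_indicator_iff measurableSet_Ioc).mpr (by simp)
  have htop : ((Ioc (0 : ℝ) 1).indicator (fun _ => (1 : ℂ))) =O[atTop]
      (fun x : ℝ => x ^ (-(s.re + 1))) := by
    refine EventuallyEq.trans_isBigO ?_ (Asymptotics.isBigO_zero _ _)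
    filter_upwards [eventually_gt_atTop 1] with x hx
    exact indicator_of_notMem (fun h => not_lt.mpr h.2 hx) _
  have hbot : ((Ioc (0 : ℝ) 1).indicator (fun _ => (1 : ℂ))) =O[𝓝[>] 0]
      (fun x : ℝ => x ^ (-(0 : ℝ))) := by
    simp only [neg_zero, Real.rpow_zero]
    refine Asymptotics.IsBigO.of_bound 1 (Eventually.of_forall (fun x => ?_))
    simpa using norm_indicator_le_norm_self (fun _ => (1 : ℂ)) x
  have key := (mellin_hasDerivAt_of_isBigO_rpow hloc htop (by linarith) hbot hs).1
  have := IntegrableOn.mono_set key (Ioc_subset_Ioi_self : Ioc (0 : ℝ) 1 ⊆ Ioi 0)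
  refine this.congr_fun (fun x hx => ?_) measurableSet_Ioc
  simp [indicator_of_mem hx]

/-! ### Taylor expansion of the cutoff near the origin -/

/-- Taylor's theorem on [0, 1] fixes the coefficients. Beyond y = 1 the remainder is bounded by
compactness and y^(m+1) ≥ 1, so only C depends on b. An arbitrary b is needed because xh ranges up
to h when x ≤ 1. -/
theorem exists_taylor_coeff {m : ℕ} {φ : ℝ → ℝ} (hφ : ContDiff ℝ (m + 1 : ℕ) φ) :
    ∃ a : ℕ → ℝ, a 0 = φ 0 ∧ ∀ b : ℝ, ∃ C, ∀ y ∈ Icc 0 b,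
      |φ y - ∑ j ∈ Finset.range (m + 1), a j * y ^ j| ≤ C * y ^ (m + 1) := by
  refine ⟨fun j => ((j.factorial : ℝ)⁻¹) * iteratedDerivWithin j φ (Icc 0 1) 0, by simp, ?_⟩
  intro b
  obtain ⟨C, hC⟩ := exists_taylor_mean_remainder_bound (f := φ) (n := m) zero_le_one
    (by exact_mod_cast hφ.contDiffOn)
  simp only [taylor_within_apply, sub_zero, smul_eq_mul, Real.norm_eq_abs] at hC
  set r : ℝ → ℝ := fun y => φ y - ∑ j ∈ Finset.range (m + 1),
    ((j.factorial : ℝ)⁻¹) * iteratedDerivWithin j φ (Icc 0 1) 0 * y ^ j with hr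
  have hcont : Continuous r := hφ.continuous.sub (by fun_prop)
  obtain ⟨D, hD⟩ := (isCompact_Icc (a := (0 : ℝ)) (b := b)).exists_bound_of_continuousOn
    hcont.continuousOn
  refine ⟨max C D, fun y hy => ?_⟩
  rcases le_or_gt y 1 with h | h
  · have e : r y = φ y - ∑ j ∈ Finset.range (m + 1),
        (j.factorial : ℝ)⁻¹ * y ^ j * iteratedDerivWithin j φ (Icc 0 1) 0 := by
      simp only [hr, mul_right_comm]
    change |r y| ≤ _
    rw [e]
    exact (hC y ⟨hy.1, h⟩).trans
      (mul_le_mul_of_nonneg_right (le_max_left _ _) (pow_nonneg hy.1 _))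
  · have hD0 : 0 ≤ D := (norm_nonneg _).trans (hD y hy)
    calc |r y| ≤ D * 1 := by simpa using hD y hy
      _ ≤ max C D * y ^ (m + 1) :=
        mul_le_mul (le_max_right _ _) (one_le_pow₀ h.le) zero_le_one (hD0.trans (le_max_right _ _))

theorem integrableOn_logIntegrand_Ioi_one {φ : ℝ → ℝ} (hφ : Continuous φ)
    (hs : HasCompactSupport φ) {h : ℝ} (hh : 0 < h) (z : ℂ) :
    IntegrableOn (logIntegrand φ z h) (Ioi 1) := by
  obtain ⟨N, -, hN⟩ := (hs.eventually_atTop_comp_mul_eq_zero hh).exists_nat_forall_ge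
  refine integrableOn_Ioi_of_eq_zero_of_le (N := N) (fun x hx => ?_)
    (fun x hx => by simp [logIntegrand, hN x hx])
  have hx0 : 0 < x := Ici_one_subset_Ioi_zero hx
  exact ((continuousAt_cpow_mul_log (-z) hx0).neg.mul (Complex.continuous_ofReal.continuousAt.comp
    (hφ.comp (continuous_mul_const h)).continuousAt)).continuousWithinAt

theorem continuousOn_cpow_mul_log_mul {r : ℝ → ℝ} (hr : Continuous r) (z : ℂ) (h : ℝ) :
    ContinuousOn (fun x : ℝ => -((x : ℂ) ^ (-z) * (Real.log x : ℂ)) * (r (x * h) : ℂ)) (Ioi 0) :=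
  fun _ hx => ((continuousAt_cpow_mul_log (-z) hx).neg.mul
    (Complex.continuous_ofReal.continuousAt.comp
      (hr.comp (continuous_mul_const h)).continuousAt)).continuousWithinAt

theorem norm_logIntegrand_le_of_remainder {r : ℝ → ℝ} {m : ℕ} {C h x : ℝ} (z : ℂ)
    (hx : 0 < x) (hr : |r (x * h)| ≤ C * (x * h) ^ m) :
    ‖logIntegrand r z h x‖ ≤
      C * h ^ m * ‖(x : ℂ) ^ ((m + 1 - z) - 1) * (Real.log x : ℂ)‖ := by
  have hx0 : (x : ℂ) ≠ 0 := by exact_mod_cast hx.ne'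
  have e : (x : ℂ) ^ ((m + 1 - z) - 1 : ℂ) = (x : ℂ) ^ (-z) * (x : ℂ) ^ m := by
    rw [← Complex.cpow_natCast, ← Complex.cpow_add _ _ hx0]
    congr 1; ring
  rw [logIntegrand, e, norm_mul, norm_neg, norm_mul, norm_mul, norm_mul, norm_pow,
    Complex.norm_real x, Real.norm_of_nonneg hx.le, Complex.norm_real (r (x * h)), Real.norm_eq_abs]
  calc _ ≤ ‖(x : ℂ) ^ (-z)‖ * ‖(Real.log x : ℂ)‖ * (C * (x * h) ^ m) :=
        mul_le_mul_of_nonneg_left hr (by positivity)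
    _ = _ := by rw [mul_pow]; ring

theorem integrableOn_Ioc_logIntegrand_of_remainder {r : ℝ → ℝ} (hrc : Continuous r) {m : ℕ}
    {C h : ℝ} {z : ℂ} (hz : z.re < m + 1) (hh : 0 < h)
    (hr : ∀ y ∈ Icc 0 h, |r y| ≤ C * y ^ m) :
    IntegrableOn (logIntegrand r z h) (Ioc 0 1) := by
  have hs : 0 < (m + 1 - z : ℂ).re := by simpa using hz
  refine Integrable.mono' ((integrableOn_Ioc_cpow_mul_log hs).norm.const_mul (C * h ^ m)) ?_ ?_
  · exact ((continuousOn_cpow_mul_log_mul hrc z h).mono Ioc_subset_Ioi_self).aestronglyMeasurable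
      measurableSet_Ioc
  · filter_upwards [ae_restrict_mem measurableSet_Ioc] with x hx
    exact norm_logIntegrand_le_of_remainder z hx.1
      (hr _ ⟨mul_nonneg hx.1.le hh.le, mul_le_of_le_one_left hh.le hx.2⟩)

/-- The bound on r extracts h^m from the integral and leaves an integrable function free of h. The
factor tends to 0 because m ≠ 0. -/
theorem tendsto_integral_Ioc_logIntegrand_of_remainder {r : ℝ → ℝ} {m : ℕ} (hm : m ≠ 0)
    {C : ℝ} {z : ℂ} (hz : z.re < m + 1)
    (hr : ∀ y ∈ Icc 0 1, |r y| ≤ C * y ^ m) :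
    Tendsto (fun h => ∫ x in Ioc (0 : ℝ) 1, logIntegrand r z h x) (𝓝[>] 0) (𝓝 0) := by
  have hs : 0 < (m + 1 - z : ℂ).re := by simpa using hz
  set I := ∫ x in Ioc (0 : ℝ) 1, ‖(x : ℂ) ^ ((m + 1 - z) - 1 : ℂ) * (Real.log x : ℂ)‖
  have hlim : Tendsto (fun h : ℝ => C * h ^ m * I) (𝓝[>] 0) (𝓝 0) := by
    have : Continuous (fun h : ℝ => C * h ^ m * I) := by fun_prop
    have := (this.tendsto 0).mono_left (nhdsWithin_le_nhds (s := Ioi 0))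
    simpa [hm] using this
  refine squeeze_zero_norm' ?_ hlim
  filter_upwards [self_mem_nhdsWithin, nhdsWithin_le_nhds (Iio_mem_nhds one_pos)] with h hh hh1
  rw [← integral_const_mul]
  refine norm_integral_le_of_norm_le ((integrableOn_Ioc_cpow_mul_log hs).norm.const_mul _) ?_
  filter_upwards [ae_restrict_mem measurableSet_Ioc] with x hx
  exact norm_logIntegrand_le_of_remainder z hx.1
    (hr _ ⟨mul_nonneg hx.1.le (le_of_lt hh), mul_le_one₀ hx.2 (le_of_lt hh) (le_of_lt hh1)⟩)

/-- The finite part of the integral of `-x ^ (-z) log x φ (x h)` exists, and tends to `(z - 1)⁻²`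
after subtraction of the integral over `(1, ∞)`. -/
theorem exists_hasFinitePart_logIntegrand {m : ℕ} {φ : ℝ → ℝ} (hφ : ContDiff ℝ (m + 1 : ℕ) φ)
    (hs : HasCompactSupport φ) (h0 : φ 0 = 1) {z : ℂ} (hz : z.re < 1 + ((m + 1 : ℕ) : ℝ))
    (hz1 : z ≠ 1) :
    ∃ Q : ℝ → ℂ, (∀ h, 0 < h →
      HasFinitePart (logIntegrand φ z h) ((∫ x in Ioi (1 : ℝ), logIntegrand φ z h x) + Q h)) ∧
      Tendsto Q (𝓝[>] 0) (𝓝 (1 / (z - 1) ^ 2)) := by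
  obtain ⟨a, ha0, ha⟩ := exists_taylor_coeff hφ
  set r : ℝ → ℝ := fun y => φ y - ∑ j ∈ Finset.range (m + 1), a j * y ^ j with hr
  have hrc : Continuous r := hφ.continuous.sub (by fun_prop)
  have hz' : z.re < ((m + 1 : ℕ) : ℝ) + 1 := by linarith
  -- Q h is the finite part over (0, 1]: the logarithmic moments of the Taylor monomials, plus the
  -- convergent integral of the remainder. Since the cut at x = 1 is fixed, no log h arises, even
  -- when some exponent 1 - z + j is 0.
  refine ⟨fun h => ∑ j ∈ Finset.range (m + 1), -((a j : ℂ) * (h : ℂ) ^ j) * logMoment (1 - z + j)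
    + ∫ x in Ioc (0 : ℝ) 1, logIntegrand r z h x, fun h hh => ?_, ?_⟩
  · obtain ⟨C, hC⟩ := ha h
    have hI1 : HasFinitePart ((Ioi (1 : ℝ)).indicator (logIntegrand φ z h))
        (∫ x in Ioi (1 : ℝ), logIntegrand φ z h x) := by
      have hi : IntegrableOn ((Ioi (1 : ℝ)).indicator (logIntegrand φ z h)) (Ioi 0) :=
        ((integrable_indicator_iff measurableSet_Ioi).mpr
          (integrableOn_logIntegrand_Ioi_one hφ.continuous hs hh z)).integrableOn
      have := hasFinitePart_of_integrableOn hi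
      rwa [setIntegral_indicator measurableSet_Ioi,
        inter_eq_right.mpr (Ioi_subset_Ioi zero_le_one)] at this
    have hI2 : HasFinitePart ((Ioc (0 : ℝ) 1).indicator (logIntegrand r z h))
        (∫ x in Ioc (0 : ℝ) 1, logIntegrand r z h x) := by
      have hi : IntegrableOn ((Ioc (0 : ℝ) 1).indicator (logIntegrand r z h)) (Ioi 0) :=
        ((integrable_indicator_iff measurableSet_Ioc).mpr
          (integrableOn_Ioc_logIntegrand_of_remainder hrc hz' hh hC)).integrableOn
      have := hasFinitePart_of_integrableOn hi
      rwa [setIntegral_indicator measurableSet_Ioc,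
        inter_eq_right.mpr Ioc_subset_Ioi_self] at this
    have hP : ∀ j ∈ Finset.range (m + 1), HasFinitePart (fun x => -((a j : ℂ) * (h : ℂ) ^ j) *
        (Ioc (0 : ℝ) 1).indicator
          (fun x => (x : ℂ) ^ ((1 - z + j) - 1 : ℂ) * (Real.log x : ℂ)) x)
        (-((a j : ℂ) * (h : ℂ) ^ j) * logMoment (1 - z + j)) :=
      fun j _ => (hasFinitePart_indicator_cpow_mul_log _).const_mul _
    refine (hI1.add ((HasFinitePart.sum hP).add hI2)).congr (fun x hx => ?_)
    have hx0 : (x : ℂ) ≠ 0 := by exact_mod_cast hx.ne'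
    rcases le_or_gt x 1 with hx1 | hx1
    · have m1 : x ∉ Ioi (1 : ℝ) := not_lt.mpr hx1
      have m2 : x ∈ Ioc (0 : ℝ) 1 := ⟨hx, hx1⟩
      have e : ∀ j : ℕ, (x : ℂ) ^ ((1 - z + j) - 1 : ℂ) = (x : ℂ) ^ (-z) * (x : ℂ) ^ j := by
        intro j
        rw [← Complex.cpow_natCast, ← Complex.cpow_add _ _ hx0]
        congr 1; ring
      simp only [indicator_of_notMem m1, indicator_of_mem m2, e, logIntegrand, hr]
      push_cast
      rw [mul_sub, Finset.mul_sum, zero_add, add_sub, add_sub_right_comm, ← Finset.sum_sub_distrib]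
      rw [Finset.sum_eq_zero (fun j _ => by rw [mul_pow]; ring), zero_add]
    · have m1 : x ∈ Ioi (1 : ℝ) := hx1
      have m2 : x ∉ Ioc (0 : ℝ) 1 := fun h => not_lt.mpr h.2 hx1
      simp [indicator_of_mem m1, indicator_of_notMem m2]
  · obtain ⟨C, hC⟩ := ha 1
    have h2 := tendsto_integral_Ioc_logIntegrand_of_remainder (Nat.succ_ne_zero m) hz' hC
    have hc : Continuous (fun h : ℝ => ∑ j ∈ Finset.range (m + 1),
        -((a j : ℂ) * (h : ℂ) ^ j) * logMoment (1 - z + j)) := by fun_prop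
    have h1 := ((hc.tendsto 0).mono_left (nhdsWithin_le_nhds (s := Ioi 0)))
    have := h1.add h2
    rw [add_zero] at this
    convert this using 2
    -- At h = 0 only j = 0 survives. Its moment is -1/(1-z)^2 and not the value 0 of the resonant
    -- case, because z ≠ 1.
    rw [Finset.sum_eq_single_of_mem 0 (by simp) (fun j _ hj => by simp [hj])]
    have hz2 : 1 - z ≠ 0 := sub_ne_zero.mpr hz1.symm
    simp only [ha0, h0, logMoment, Nat.cast_zero, add_zero, if_neg hz2]
    rw [show (z - 1) ^ 2 = (1 - z) ^ 2 by ring]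
    simp

/-! ### The differential zeta connection -/

theorem IsCutoff.of_le {p q : ℕ∞} {η : ℝ → ℝ} (hη : IsCutoff p η) (hqp : q ≤ p) : IsCutoff q η :=
  ⟨hη.contDiff.of_le (by exact_mod_cast hqp), hη.hasCompactSupport, hη.even, hη.map_zero⟩

/-- With t = |Re z - 1| this supplies a finite order of smoothness m + 1 for which -m < Re z < m +
2, the strip where both halves of the argument apply. -/
theorem exists_nat_lt_of_ofReal_lt {p : ℕ∞} {t : ℝ} (ht : ENNReal.ofReal t < (p : ENNReal)) :
    ∃ m : ℕ, ((m + 1 : ℕ) : ℕ∞) ≤ p ∧ t < ((m + 1 : ℕ) : ℝ) := by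
  induction p using ENat.recTopCoe with
  | top =>
    obtain ⟨m, hm⟩ := exists_nat_gt t
    exact ⟨m, le_top, hm.trans (by simp)⟩
  | coe n =>
    have hn : n ≠ 0 := by rintro rfl; simp at ht
    obtain ⟨m, rfl⟩ := Nat.exists_eq_succ_of_ne_zero hn
    refine ⟨m, le_rfl, ?_⟩
    have h : ENNReal.ofReal t < ((m.succ : ℕ) : ENNReal) := by simpa using ht
    rw [← ENNReal.ofReal_natCast] at h
    exact (ENNReal.ofReal_lt_ofReal_iff (by positivity)).mp h

theorem integrableOn_logIntegrand_Ioi_zero {φ : ℝ → ℝ} (hφ : Continuous φ)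
    (hs : HasCompactSupport φ) {h : ℝ} (hh : 0 < h) {z : ℂ} (hz : z.re < 1) :
    IntegrableOn (logIntegrand φ z h) (Ioi 0) := by
  obtain ⟨C, hC⟩ := hs.exists_bound_of_continuous hφ
  have h1 : IntegrableOn (logIntegrand φ z h) (Ioc 0 1) :=
    -- With m = 0 the remainder bound is plain boundedness of φ, which suffices for Re z < 1.
    integrableOn_Ioc_logIntegrand_of_remainder (m := 0) (C := C) hφ (by simpa using hz) hh
      (fun y _ => by simpa using hC y)
  have := h1.union (integrableOn_logIntegrand_Ioi_one hφ hs hh z)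
  rwa [Ioc_union_Ioi_eq_Ioi zero_le_one] at this

/-- The differential zeta connection. -/
theorem IsCutoff.tendsto_logSum_sub_finitePart {p : ℕ∞} {η : ℝ → ℝ} (hη : IsCutoff p η) {z : ℂ}
    (hz1 : z ≠ 1) (hz : ENNReal.ofReal |z.re - 1| < (p : ENNReal)) :
    (∀ h : ℝ, 0 < h → ∃ L : ℂ, HasFinitePart (logIntegrand η z h) L) ∧
      Tendsto (fun h : ℝ => logSum η z h - finitePart (logIntegrand η z h))
        (𝓝[>] 0) (𝓝 (deriv riemannZeta z)) := by
  obtain ⟨m, hmp, hm⟩ := exists_nat_lt_of_ofReal_lt hz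
  have hc : ContDiff ℝ (m + 1 : ℕ) η := (hη.of_le hmp).contDiff
  obtain ⟨hm1, hm2⟩ := abs_lt.mp hm
  obtain ⟨Q, hQ, hQlim⟩ := exists_hasFinitePart_logIntegrand hc hη.hasCompactSupport hη.map_zero
    (z := z) (by linarith) hz1
  refine ⟨fun h hh => ⟨_, hQ h hh⟩, ?_⟩
  have h1 := (tendsto_logSum_sub_integral_Ioi_one hc hη.hasCompactSupport hη.map_zero
    (z := z) (by linarith) hz1).sub hQlim
  rw [add_sub_cancel_right] at h1
  refine h1.congr' ?_
  filter_upwards [self_mem_nhdsWithin] with h hh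
  rw [(hQ h hh).finitePart_eq]
  ring

theorem IsCutoff.tendsto_logSum_sub_integral {p : ℕ∞} {η : ℝ → ℝ} (hη : IsCutoff p η) {z : ℂ}
    (hz1 : z.re < 1) (hz : ENNReal.ofReal |z.re - 1| < (p : ENNReal)) :
    Tendsto (fun h : ℝ => logSum η z h - ∫ x in Ioi (0 : ℝ), logIntegrand η z h x)
      (𝓝[>] 0) (𝓝 (deriv riemannZeta z)) := by
  have hne : z ≠ 1 := by rintro rfl; simp at hz1
  refine (hη.tendsto_logSum_sub_finitePart hne hz).2.congr' ?_
  filter_upwards [self_mem_nhdsWithin] with h hh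
  rw [(hasFinitePart_of_integrableOn (integrableOn_logIntegrand_Ioi_zero hη.contDiff.continuous
    hη.hasCompactSupport hh hz1)).finitePart_eq]

/-! ### The moment-fitting system and its limit -/

/-- The matrix of the moment-fitting equations. -/
noncomputable def momentMatrix (η : ℝ → ℝ) (K : ℕ) (h : ℝ) :
    Matrix (Fin (K + 1)) (Fin (K + 1)) ℝ :=
  Matrix.of fun k j => (j : ℝ) ^ (2 * (k : ℕ)) * η ((j : ℝ) * h)

/-- The right-hand side of the moment-fitting equations. -/
noncomputable def momentDefect (η : ℝ → ℝ) (k : ℕ) (h : ℝ) : ℝ :=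
  (∫ x in Ioi (0 : ℝ), -(x ^ (2 * k) * Real.log x) * η (x * h)) -
    ∑' n : ℕ, -(((n : ℝ) + 1) ^ (2 * k) * Real.log ((n : ℝ) + 1)) * η (((n : ℝ) + 1) * h)

theorem solvesLogMomentSystem_iff (η : ℝ → ℝ) (K : ℕ) (h : ℝ) (w : Fin (K + 1) → ℝ) :
    SolvesLogMomentSystem η K h w ↔
      (momentMatrix η K h).mulVec w = fun k : Fin (K + 1) => momentDefect η k h := by
  rw [funext_iff]
  refine forall_congr' (fun k => ?_)
  simp only [Matrix.mulVec, dotProduct, momentMatrix, momentDefect, Matrix.of_apply]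
  rw [Finset.sum_congr rfl (fun j _ => show w j * (j : ℝ) ^ (2 * (k : ℕ)) * η ((j : ℝ) * h) =
    (j : ℝ) ^ (2 * (k : ℕ)) * η ((j : ℝ) * h) * w j by ring)]

theorem det_momentMatrix_zero_ne_zero {η : ℝ → ℝ} (h0 : η 0 = 1) (K : ℕ) :
    (momentMatrix η K 0).det ≠ 0 := by
  have e : momentMatrix η K 0 =
      (Matrix.vandermonde (fun j : Fin (K + 1) => ((j : ℕ) : ℝ) ^ 2)).transpose := by
    ext k j
    simp [momentMatrix, h0, Matrix.vandermonde_apply, pow_mul]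
  rw [e, Matrix.det_transpose, Matrix.det_vandermonde_ne_zero_iff]
  intro i j hij
  have := (pow_left_inj₀ (Nat.cast_nonneg (i : ℕ)) (Nat.cast_nonneg (j : ℕ)) two_ne_zero).mp hij
  exact Fin.ext (by exact_mod_cast this)

theorem continuous_momentMatrix {η : ℝ → ℝ} (hη : Continuous η) (K : ℕ) :
    Continuous (momentMatrix η K) := by
  refine continuous_matrix (fun k j => ?_)
  simp only [momentMatrix, Matrix.of_apply]
  fun_prop

theorem Matrix.mulVec_eq_iff_eq_inv_mulVec {n R : Type*} [Fintype n] [DecidableEq n] [CommRing R]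
    {A : Matrix n n R} (hA : IsUnit A.det) {v b : n → R} :
    A.mulVec v = b ↔ v = A⁻¹.mulVec b := by
  constructor
  · rintro rfl
    rw [Matrix.mulVec_mulVec, Matrix.nonsing_inv_mul _ hA, Matrix.one_mulVec]
  · rintro rfl
    rw [Matrix.mulVec_mulVec, Matrix.mul_nonsing_inv _ hA, Matrix.one_mulVec]

theorem logIntegrand_neg_two_mul (η : ℝ → ℝ) (k : ℕ) (h x : ℝ) :
    logIntegrand η (-2 * (k : ℂ)) h x =
      ((-(x ^ (2 * k) * Real.log x) * η (x * h) : ℝ) : ℂ) := by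
  rw [logIntegrand, show -(-2 * (k : ℂ)) = ((2 * k : ℕ) : ℂ) by push_cast; ring,
    Complex.cpow_natCast]
  push_cast
  rfl

theorem ofReal_momentDefect (η : ℝ → ℝ) (k : ℕ) (h : ℝ) :
    (momentDefect η k h : ℂ) =
      -(logSum η (-2 * (k : ℂ)) h - ∫ x in Ioi (0 : ℝ), logIntegrand η (-2 * (k : ℂ)) h x) := by
  simp only [logSum, logIntegrand_neg_two_mul]
  rw [integral_complex_ofReal, ← Complex.ofReal_tsum, momentDefect, ← Complex.ofReal_sub,
    ← Complex.ofReal_neg, neg_sub]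

/-- The distance from -2k to 1 is 2k + 1, which is where the smoothness requirement comes from. -/
theorem IsCutoff.tendsto_momentDefect {p : ℕ∞} {η : ℝ → ℝ} (hη : IsCutoff p η) {k : ℕ}
    (hk : ((2 * k + 1 : ℕ) : ℕ∞) < p) :
    ∃ β : ℝ, (β : ℂ) = -deriv riemannZeta (-2 * (k : ℂ)) ∧
      Tendsto (momentDefect η k) (𝓝[>] 0) (𝓝 β) := by
  have hre : (-2 * (k : ℂ)).re = -2 * (k : ℝ) := by simp
  have hk0 : (0 : ℝ) ≤ k := Nat.cast_nonneg k
  have habs : |(-2 * (k : ℂ)).re - 1| = ((2 * k + 1 : ℕ) : ℝ) := by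
    rw [hre, abs_of_nonpos (by linarith)]
    push_cast; ring
  have hz : ENNReal.ofReal |(-2 * (k : ℂ)).re - 1| < (p : ENNReal) := by
    rw [habs, ENNReal.ofReal_natCast]
    exact_mod_cast hk
  have h1 := (hη.tendsto_logSum_sub_integral (by rw [hre]; linarith) hz).neg
  simp only [← ofReal_momentDefect] at h1
  have h2 := (Complex.continuous_re.tendsto _).comp h1
  have h3 : Tendsto (momentDefect η k) (𝓝[>] 0) (𝓝 (-deriv riemannZeta (-2 * (k : ℂ))).re) := by
    simpa [Function.comp_def] using h2
  -- The derivative ζ'(-2k) is real because it is a limit of real numbers.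
  exact ⟨_, tendsto_nhds_unique ((Complex.continuous_ofReal.tendsto _).comp h3) h1, h3⟩

theorem solvesZetaPrimeSystem_iff {η : ℝ → ℝ} (h0 : η 0 = 1) {K : ℕ} {β : Fin (K + 1) → ℝ}
    (hβ : ∀ k, (β k : ℂ) = -deriv riemannZeta (-2 * ((k : ℕ) : ℂ))) (v : Fin (K + 1) → ℝ) :
    SolvesZetaPrimeSystem K v ↔ (momentMatrix η K 0).mulVec v = β := by
  rw [funext_iff]
  refine forall_congr' (fun k => ?_)
  rw [← hβ, ← Complex.ofReal_inj]
  simp [Matrix.mulVec, dotProduct, momentMatrix, h0, mul_comm]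

theorem IsCutoff.logMomentSystem {p : ℕ∞} {η : ℝ → ℝ} (hη : IsCutoff p η) {K : ℕ}
    (hK : ((2 * K + 1 : ℕ) : ℕ∞) < p) :
    (∀ᶠ h in 𝓝[>] (0 : ℝ), ∃! v : Fin (K + 1) → ℝ, SolvesLogMomentSystem η K h v) ∧
      ∃ w : Fin (K + 1) → ℝ,
        (∀ W : ℝ → Fin (K + 1) → ℝ,
          (∀ᶠ h in 𝓝[>] (0 : ℝ), SolvesLogMomentSystem η K h (W h)) →
            ∀ j, Tendsto (fun h => W h j) (𝓝[>] 0) (𝓝 (w j))) ∧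
        ∀ v : Fin (K + 1) → ℝ, SolvesZetaPrimeSystem K v ↔ v = w := by
  have hβ : ∀ k : Fin (K + 1), ∃ β : ℝ, (β : ℂ) = -deriv riemannZeta (-2 * ((k : ℕ) : ℂ)) ∧
      Tendsto (momentDefect η k) (𝓝[>] 0) (𝓝 β) := by
    intro k
    refine hη.tendsto_momentDefect (lt_of_le_of_lt ?_ hK)
    have := k.is_le
    exact_mod_cast (by omega : 2 * (k : ℕ) + 1 ≤ 2 * K + 1)
  choose β hβ hlim using hβ
  have hM := continuous_momentMatrix hη.contDiff.continuous K
  have hdet0 := det_momentMatrix_zero_ne_zero hη.map_zero K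
  have hMlim : Tendsto (momentMatrix η K) (𝓝[>] 0) (𝓝 (momentMatrix η K 0)) :=
    (hM.tendsto 0).mono_left nhdsWithin_le_nhds
  have hdet : ∀ᶠ h in 𝓝[>] (0 : ℝ), IsUnit (momentMatrix η K h).det := by
    have : Tendsto (fun h => (momentMatrix η K h).det) (𝓝[>] 0) (𝓝 (momentMatrix η K 0).det) :=
      (hM.matrix_det.tendsto 0).mono_left nhdsWithin_le_nhds
    filter_upwards [this.eventually_ne hdet0] with h hh using isUnit_iff_ne_zero.mpr hh
  refine ⟨?_, (momentMatrix η K 0)⁻¹.mulVec β, fun W hW => ?_, fun v => ?_⟩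
  · filter_upwards [hdet] with h hh
    simp only [solvesLogMomentSystem_iff, Matrix.mulVec_eq_iff_eq_inv_mulVec hh]
    exact existsUnique_eq
  · rw [← tendsto_pi_nhds]
    -- The inverse is the adjugate divided by the determinant, hence continuous at h = 0, where the
    -- determinant is nonzero.
    have hinv : Tendsto (fun h => (momentMatrix η K h)⁻¹) (𝓝[>] 0) (𝓝 (momentMatrix η K 0)⁻¹) := by
      simp only [Matrix.inv_def, Ring.inverse_eq_inv']
      exact (((hM.matrix_det.tendsto 0).inv₀ hdet0).smul
        (hM.matrix_adjugate.tendsto 0)).mono_left nhdsWithin_le_nhds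
    have hvec : Tendsto (fun h => (momentMatrix η K h)⁻¹.mulVec
        (fun k : Fin (K + 1) => momentDefect η k h)) (𝓝[>] 0)
        (𝓝 ((momentMatrix η K 0)⁻¹.mulVec β)) := by
      have hc : Continuous (fun q : Matrix (Fin (K + 1)) (Fin (K + 1)) ℝ × (Fin (K + 1) → ℝ) =>
        q.1.mulVec q.2) := continuous_fst.matrix_mulVec continuous_snd
      exact (hc.tendsto _).comp (hinv.prodMk_nhds (tendsto_pi_nhds.mpr hlim))
    refine hvec.congr' ?_
    filter_upwards [hdet, hW] with h hh hWh
    rw [solvesLogMomentSystem_iff, Matrix.mulVec_eq_iff_eq_inv_mulVec hh] at hWh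
    exact hWh.symm
  · rw [solvesZetaPrimeSystem_iff hη.map_zero hβ,
      Matrix.mulVec_eq_iff_eq_inv_mulVec (isUnit_iff_ne_zero.mpr hdet0)]

theorem mainTheorem1 (p : ℕ∞) (η : ℝ → ℝ) (hη : IsCutoff p η) :
    (∀ z : ℂ, z ≠ 1 → ENNReal.ofReal |z.re - 1| < (p : ENNReal) →
      (∀ h : ℝ, 0 < h → ∃ L : ℂ, HasFinitePart (logIntegrand η z h) L) ∧
      Tendsto (fun h : ℝ => logSum η z h - finitePart (logIntegrand η z h))
        (𝓝[>] 0) (𝓝 (deriv riemannZeta z)) ∧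
      (z.re < 1 →
        (∀ h : ℝ, 0 < h → IntegrableOn (logIntegrand η z h) (Ioi 0)) ∧
        Tendsto (fun h : ℝ => logSum η z h - ∫ x in Ioi (0 : ℝ), logIntegrand η z h x)
          (𝓝[>] 0) (𝓝 (deriv riemannZeta z)))) ∧
    (∀ K : ℕ, ((2 * K + 1 : ℕ) : ℕ∞) < p →
      (∀ᶠ h in 𝓝[>] (0 : ℝ), ∃! v : Fin (K + 1) → ℝ, SolvesLogMomentSystem η K h v) ∧
      ∃ w : Fin (K + 1) → ℝ,
        (∀ W : ℝ → Fin (K + 1) → ℝ,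
          (∀ᶠ h in 𝓝[>] (0 : ℝ), SolvesLogMomentSystem η K h (W h)) →
            ∀ j, Tendsto (fun h => W h j) (𝓝[>] 0) (𝓝 (w j))) ∧
        ∀ v : Fin (K + 1) → ℝ, SolvesZetaPrimeSystem K v ↔ v = w) := by
  refine ⟨fun z hz1 hz => ?_, fun K hK => hη.logMomentSystem hK⟩
  obtain ⟨h1, h2⟩ := hη.tendsto_logSum_sub_finitePart hz1 hz
  refine ⟨h1, h2, fun hre => ⟨fun h hh => ?_, hη.tendsto_logSum_sub_integral hre hz⟩⟩
  exact integrableOn_logIntegrand_Ioi_zero hη.contDiff.continuous hη.hasCompactSupport hh hre
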